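/- Write $[n]=\{1,\dots,n\}$, and let $\binom{[n]}{k}$ be the set of all $k$-element subsets of $[n]$. Families $\mathcal A,\mathcal B$ of sets are called cross $t$-intersecting if $|A\cap B|\ge t$ for all $A\in\mathcal A$ and $B\in\mathcal B$. A family $\mathcal A$ of subsets of $[n]$ is called shifted if, whenever $1\le i<j\le n$, $A\in\mathcal A$ and $A\cap\{i,j\}=\{j\}$, also $(A\setminus\{j\})\cup\{i\}\in\mathcal A$. Let $\mathcal F_0^t(n,k)=\{F\in\binom{[n]}{k}:[t]\subseteq F\}$, and let $\mathcal A\bigtriangleup\mathcal F=(\mathcal A\setminus\mathcal F)\cup(\mathcal F\setminus\mathcal A)$. Theorem. For every integer $t\ge 14$ and every real $\delta>0$ there is a constant $\gamma=\gamma(t,\delta)\in(0,1]$ such that the following holds for all integers $k\ge t$, all integers $n\ge(t+1+\delta)k$ and all real $\eta\in(0,1]$. If $\mathcal A,\mathcal B\subseteq\binom{[n]}{k}$ are shifted and cross $t$-intersecting, then at least one of the following holds: (i) $\sqrt{|\mathcal A||\mathcal B|}<(1-\gamma\eta)\binom{n-t}{k-t}$; (ii) $|\mathcal A\bigtriangleup\mathcal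 F_0^t(n,k)|+|\mathcal B\bigtriangleup\mathcal F_0^t(n,k)|<\eta\binom{n-t}{k-t}$. -/

import Mathlib

/-- `A` is a `k`-uniform family on `[n] = {1, …, n}`, that is, a set of `k`-subsets of `[n]`. -/
def IsUniformFamily (n k : ℕ) (A : Finset (Finset ℕ)) : Prop :=
  A ⊆ (Finset.Icc 1 n).powersetCard k

/-- `A` and `B` are cross `t`-intersecting. -/
def CrossIntersecting (t : ℕ) (A B : Finset (Finset ℕ)) : Prop :=
  ∀ F ∈ A, ∀ G ∈ B, t ≤ (F ∩ G).card

/-- `A` is a shifted family on `[n]`: replacing an element `j` of a member by a smaller `i ≥ 1`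
that is not in the member gives a member again. -/
def IsShifted (n : ℕ) (A : Finset (Finset ℕ)) : Prop :=
  ∀ i j : ℕ, 1 ≤ i → i < j → j ≤ n → ∀ F ∈ A,
    F ∩ {i, j} = {j} → (F \ {j}) ∪ {i} ∈ A

/-- The family of all `F ∈ ([n] choose k)` with `|F ∩ [t + 2 i]| ≥ t + i`. -/
def franklFamily (i t n k : ℕ) : Finset (Finset ℕ) :=
  ((Finset.Icc 1 n).powersetCard k).filter
    fun F => t + i ≤ (F ∩ Finset.Icc 1 (t + 2 * i)).card

/-!
A set `F ⊆ [n]` is read as a walk that goes up at step `i` if `i ∈ F` and down otherwise. If `A` and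
`B` are shifted and cross `t`-intersecting, then the walks of any `F ∈ A` and `G ∈ B` have, at some
common time, heights that sum to at least `2 * t` (`exists_prefixCard_add`). Let `u` and `v` be the
largest heights that all walks of `A`, respectively of `B`, reach. Then `u + v ≥ 2 * t`.

With `l = n - k`, the reflection principle bounds the number of walks reaching `u` by
`n.choose (l + u)`, which for `u = t` is less than `e` times `C = (n - t).choose (k - t)`, and each
further unit of height costs a factor `t`. By log-concavity, `u + v > 2 * t` gives
`|A| * |B| ≤ e ^ 2 / t * C ^ 2`. If `u + v = 2 * t` and all walks of `A` are at height `u` or more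
twice, or all walks of `B` at height `v`, the bound is `2 * e ^ 2 / (t + 1) * C ^ 2`; this is where
`t ≥ 14` enters. In the remaining case both families have walks that are at height `u`, respectively `v`, at a single time `T`, and
`T` is the same for both families (`level_trichotomy`). Let `s` and `s'` be the numbers of
down-steps up to `T`, so that `T = t + s + s'`. Every walk of `A` reaches `u + 1` or has at most `s`
down-steps up to `T`, and similarly for `B`. If `s` or `s'` is at least `2`, counting suffices
(`card_mul_card_le_of_two_le`).

For `s, s' ≤ 1`, let `A₀` and `B₀` be the families of all sets that miss at most `s`, respectively
`s'`, elements of `[T]`. A member `F` of `A` outside `A₀` must reach `u + 1`, so there are few of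
them; and the one with the lowest peak excludes from `B` those sets in `B₀` that contain `(t, T]`,
go down for long enough after `T`, and rise by at most one from there (`choose_mul_le_card_sdiff`). Measured as shares of `A₀` and `B₀`, what `A` gains
outside `A₀` is at most half of what `B` loses inside `B₀`, and conversely
(`two_mul_gain_le_loss`). Hence `|A| * |B| ≤ |A₀| * |B₀|`, which is bounded away from `C ^ 2`
unless `s = s' = 0`; only `s = s' = 1` needs the gap `δ` for that. For `s = s' = 0` both `A₀` and
`B₀` are the family of all sets containing `[t]`, and large symmetric differences mean large
losses.
-/

namespace ShiftedFamilies
open Finset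

/-! ### Walks of sets -/

/-- The number of elements of `F` among `1, …, i`. The walk of `F` is at height
`2 * prefixCard F i - i` after `i` steps. -/
def prefixCard (F : Finset ℕ) (i : ℕ) : ℕ := #(F ∩ Icc 1 i)

/-- The walk of `F` has height at least `w` at some time `i ≤ n`. -/
def Reaches (n w : ℕ) (F : Finset ℕ) : Prop := ∃ i ≤ n, i + w ≤ 2 * prefixCard F i

/-- The walk of `F` has height at least `w` at two different times up to `n`. A walk that climbs
above height `w` also does so, being at height at least `w` one step earlier. -/
def ReachesTwice (n w : ℕ) (F : Finset ℕ) : Prop :=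
  ∃ j ≤ n, ∃ i < j, i + w ≤ 2 * prefixCard F i ∧ j + w ≤ 2 * prefixCard F j

@[simp] lemma prefixCard_zero (F : Finset ℕ) : prefixCard F 0 = 0 := by simp [prefixCard]

lemma prefixCard_succ (F : Finset ℕ) (i : ℕ) :
    prefixCard F (i + 1) = prefixCard F i + if i + 1 ∈ F then 1 else 0 := by
  unfold prefixCard
  have h : Icc 1 (i + 1) = insert (i + 1) (Icc 1 i) := by ext; simp; omega
  split_ifs with hF
  · rw [h, inter_insert_of_mem hF, card_insert_of_notMem (by simp)]
  · rw [h, inter_insert_of_notMem hF, add_zero]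

lemma prefixCard_le_self (F : Finset ℕ) (i : ℕ) : prefixCard F i ≤ i :=
  (card_le_card inter_subset_right).trans (by simp)

lemma prefixCard_le_card (F : Finset ℕ) (i : ℕ) : prefixCard F i ≤ #F :=
  card_le_card inter_subset_left

lemma prefixCard_add_le (F : Finset ℕ) (i j : ℕ) :
    prefixCard F (i + j) ≤ prefixCard F i + j := by
  induction j with
  | zero => simp
  | succ j ih => rw [← add_assoc, prefixCard_succ]; split_ifs <;> omega

lemma prefixCard_mono (F : Finset ℕ) {i j : ℕ} (h : i ≤ j) : prefixCard F i ≤ prefixCard F j :=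
  card_le_card (inter_subset_inter_left (Icc_subset_Icc_right h))

lemma prefixCard_eq_card {n : ℕ} {F : Finset ℕ} (h : F ⊆ Icc 1 n) : prefixCard F n = #F := by
  rw [prefixCard, inter_eq_left.2 h]

lemma prefixCard_insert {n i : ℕ} (F : Finset ℕ) (h : i < n) :
    prefixCard (insert n F) i = prefixCard F i := by
  unfold prefixCard
  rw [insert_inter_of_notMem (by simp; omega)]

lemma reaches_zero (n : ℕ) (F : Finset ℕ) : Reaches n 0 F := ⟨0, by simp, by simp⟩

lemma Reaches.le_card {n w : ℕ} {F : Finset ℕ} (h : Reaches n w F) : w ≤ #F := by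
  obtain ⟨i, hi, h⟩ := h
  have := prefixCard_le_self F i
  have := prefixCard_le_card F i
  omega

lemma Reaches.reachesTwice {n w : ℕ} {F : Finset ℕ} (h : Reaches n (w + 1) F) :
    ReachesTwice n w F := by
  obtain ⟨i, hi, h⟩ := h
  obtain _ | i := i
  · simp at h
  · refine ⟨i + 1, hi, i, by omega, ?_, by omega⟩
    have := prefixCard_add_le F i 1
    omega

/-! ### Counting walks -/

section Counting
open scoped Classical

lemma card_filter_powersetCard_succ_le (n k : ℕ) (P Q Q' : Finset ℕ → Prop)
    (hQ : ∀ F ⊆ Icc 1 n, #F = k + 1 → P F → Q F)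
    (hQ' : ∀ F ⊆ Icc 1 n, #F = k → P (insert (n + 1) F) → Q' F) :
    #{F ∈ powersetCard (k + 1) (Icc 1 (n + 1)) | P F} ≤
      #{F ∈ powersetCard (k + 1) (Icc 1 n) | Q F} + #{F ∈ powersetCard k (Icc 1 n) | Q' F} := by
  have h : Icc 1 (n + 1) = insert (n + 1) (Icc 1 n) := by ext; simp; omega
  rw [h, powersetCard_succ_insert (by simp), filter_union, filter_image]
  refine (card_union_le _ _).trans (add_le_add ?_ (card_image_le.trans ?_))
  · refine card_le_card fun F hF => ?_
    simp only [mem_filter, mem_powersetCard] at hF ⊢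
    exact ⟨hF.1, hQ F hF.1.1 hF.1.2 hF.2⟩
  · refine card_le_card fun F hF => ?_
    simp only [mem_filter, mem_powersetCard] at hF ⊢
    exact ⟨hF.1, hQ' F hF.1.1 hF.1.2 hF.2⟩

lemma Reaches.of_succ {n w : ℕ} {F : Finset ℕ} (h : Reaches (n + 1) w F)
    (hn : 2 * prefixCard F (n + 1) < n + 1 + w) : Reaches n w F := by
  obtain ⟨i, hi, h⟩ := h
  rcases hi.eq_or_lt with rfl | hi
  · omega
  · exact ⟨i, by omega, h⟩

lemma Reaches.of_insert {n w : ℕ} {F : Finset ℕ} (h : Reaches n w (insert (n + 1) F)) :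
    Reaches n w F := by
  obtain ⟨i, hi, h⟩ := h
  exact ⟨i, hi, by rwa [prefixCard_insert F (by omega)] at h⟩

/-- The reflection bound: at most as many walks with `k` up-steps and `l` down-steps reach height
`w` as there are walks with `k - w` up-steps and `l + w` down-steps. -/
lemma card_reaches_le (n k l w : ℕ) (hn : k + l = n) (h : k ≤ l + w) :
    #{F ∈ powersetCard k (Icc 1 n) | Reaches n w F} ≤ n.choose (l + w) := by
  induction n generalizing k l with
  | zero =>
    obtain ⟨rfl, rfl⟩ : k = 0 ∧ l = 0 := by omega
    obtain _ | w := w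
    · exact (card_filter_le _ _).trans (by simp)
    · simp [Reaches]
  | succ n ih =>
    by_cases hw : k < w
    · rw [card_eq_zero.2]
      · simp
      · refine filter_eq_empty_iff.2 fun F hF hr => ?_
        have := hr.le_card
        rw [(mem_powersetCard.1 hF).2] at this
        omega
    rcases h.eq_or_lt with h | h
    · refine (card_filter_le _ _).trans ?_
      rw [card_powersetCard, Nat.card_Icc, ← h, Nat.add_sub_cancel]
    obtain _ | l := l
    · omega
    obtain _ | k := k
    · obtain rfl : w = 0 := by omega
      refine (card_filter_le _ _).trans ?_
      rw [card_powersetCard, show l + 1 + 0 = n + 1 by omega]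
      simp
    · have hk := card_filter_powersetCard_succ_le n k (Reaches (n + 1) w) (Reaches n w)
        (Reaches n w)
        (fun F hF hc hr => hr.of_succ (by have := prefixCard_le_card F (n + 1); omega))
        (fun F hF hc hr => (hr.of_succ (by
          have := prefixCard_le_card (insert (n + 1) F) (n + 1)
          have := card_insert_le (n + 1) F
          omega)).of_insert)
      have h1 := ih (k + 1) l (by omega) (by omega)
      have h2 := ih k (l + 1) (by omega) (by omega)
      rw [show l + 1 + w = l + w + 1 by omega] at h2 ⊢
      rw [Nat.choose_succ_succ']
      omega

lemma ReachesTwice.of_succ {n w : ℕ} {F : Finset ℕ} (h : ReachesTwice (n + 1) w F)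
    (hn : 2 * prefixCard F (n + 1) < n + 1 + w) : ReachesTwice n w F := by
  obtain ⟨j, hj, i, hi, h, h'⟩ := h
  rcases hj.eq_or_lt with rfl | hj
  · omega
  · exact ⟨j, by omega, i, hi, h, h'⟩

lemma ReachesTwice.of_insert {n w : ℕ} {F : Finset ℕ}
    (h : ReachesTwice n w (insert (n + 1) F)) : ReachesTwice n w F := by
  obtain ⟨j, hj, i, hi, h, h'⟩ := h
  rw [prefixCard_insert F (by omega)] at h h'
  exact ⟨j, hj, i, hi, h, h'⟩

lemma ReachesTwice.reaches_pred {n w : ℕ} {F : Finset ℕ} (h : ReachesTwice (n + 1) w F) :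
    Reaches n w F := by
  obtain ⟨j, hj, i, hi, h, h'⟩ := h
  exact ⟨i, by omega, h⟩

lemma ReachesTwice.lt_card {n w : ℕ} {F : Finset ℕ} (h : ReachesTwice n w F) : w < #F := by
  obtain ⟨j, hj, i, hi, h, h'⟩ := h
  have := prefixCard_le_self F i
  have := prefixCard_le_card F j
  omega

/-- The reflection bound for walks that are at height at least `w` twice. -/
lemma card_reachesTwice_le (n k l w : ℕ) (hn : k + l = n + 1) (h : k ≤ l + w) :
    #{F ∈ powersetCard k (Icc 1 (n + 1)) | ReachesTwice (n + 1) w F} ≤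
      2 * n.choose (l + w) := by
  induction n generalizing k l with
  | zero =>
    rw [card_eq_zero.2]
    · simp
    · refine filter_eq_empty_iff.2 fun F hF ⟨j, hj, i, hi, h1, h2⟩ => ?_
      obtain rfl : i = 0 := by omega
      have := (mem_powersetCard.1 hF).2
      have := prefixCard_le_card F j
      have := prefixCard_le_self F j
      simp at h1
      omega
  | succ n ih =>
    by_cases hw : k ≤ w
    · rw [card_eq_zero.2]
      · simp
      · refine filter_eq_empty_iff.2 fun F hF hr => ?_
        have := hr.lt_card
        rw [(mem_powersetCard.1 hF).2] at this
        omega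
    obtain _ | k := k
    · omega
    rcases h.eq_or_lt with h | h
    · have hk := card_filter_powersetCard_succ_le (n + 1) k (ReachesTwice (n + 1 + 1) w)
        (Reaches (n + 1) 0) (Reaches (n + 1) w) (fun F _ _ _ => reaches_zero _ F)
        (fun F hF hc hr => hr.reaches_pred.of_insert)
      have h1 := card_reaches_le (n + 1) k l w (by omega) (by omega)
      refine hk.trans ((add_le_add ((card_filter_le _ _).trans ?_) h1).trans (two_mul _).ge)
      rw [card_powersetCard, Nat.card_Icc, ← h, Nat.add_sub_cancel]
    · obtain _ | l := l
      · omega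
      have hk := card_filter_powersetCard_succ_le (n + 1) k (ReachesTwice (n + 1 + 1) w)
        (ReachesTwice (n + 1) w) (ReachesTwice (n + 1) w)
        (fun F hF hc hr => hr.of_succ (by have := prefixCard_le_card F (n + 1 + 1); omega))
        (fun F hF hc hr => (hr.of_succ (by
          have := prefixCard_le_card (insert (n + 1 + 1) F) (n + 1 + 1)
          have := card_insert_le (n + 1 + 1) F
          omega)).of_insert)
      have h1 := ih (k + 1) l (by omega) (by omega)
      have h2 := ih k (l + 1) (by omega) (by omega)
      rw [show l + 1 + w = l + w + 1 by omega] at h2 ⊢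
      rw [Nat.choose_succ_succ']
      omega

/-- A `k`-subset of `[n]` with exactly `j` elements in `[T]` splits into its parts in `[T]` and in
`(T, n]`. -/
lemma card_filter_prefixCard_eq (n k T j : ℕ) (hT : T ≤ n) (hj : j ≤ k) :
    #{F ∈ powersetCard k (Icc 1 n) | prefixCard F T = j} = T.choose j * (n - T).choose (k - j) := by
  have h1 : #(powersetCard j (Icc 1 T) ×ˢ powersetCard (k - j) (Icc (T + 1) n)) =
      T.choose j * (n - T).choose (k - j) := by
    rw [card_product, card_powersetCard, card_powersetCard, Nat.card_Icc, Nat.card_Icc]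
    congr 2; omega
  rw [← h1]
  refine card_bij' (fun F _ => (F ∩ Icc 1 T, F ∩ Icc (T + 1) n)) (fun P _ => P.1 ∪ P.2) ?_ ?_ ?_ ?_
  · intro F hF
    rw [mem_filter, mem_powersetCard, prefixCard] at hF
    obtain ⟨⟨hF, hc⟩, hj'⟩ := hF
    simp only [mem_product, mem_powersetCard, inter_subset_right, true_and]
    refine ⟨hj', ?_⟩
    have h2 : F ∩ Icc (T + 1) n = F \ (F ∩ Icc 1 T) := by
      ext x
      have := @hF x
      simp only [mem_inter, mem_sdiff, mem_Icc] at this ⊢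
      grind
    rw [h2, card_sdiff_of_subset inter_subset_left]
    omega
  · intro P hP
    simp only [mem_product, mem_powersetCard] at hP
    obtain ⟨⟨h2, h3⟩, h4, h5⟩ := hP
    have h6 : Disjoint P.1 P.2 := by
      rw [disjoint_left]
      intro x hx hx'
      have := h2 hx
      have := h4 hx'
      simp only [mem_Icc] at *
      omega
    rw [mem_filter, mem_powersetCard, prefixCard]
    refine ⟨⟨union_subset (h2.trans (Icc_subset_Icc_right hT))
      (h4.trans (Icc_subset_Icc_left (by omega))), ?_⟩, ?_⟩
    · rw [card_union_of_disjoint h6]; omega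
    · have : (P.1 ∪ P.2) ∩ Icc 1 T = P.1 := by
        ext x
        have := @h2 x
        have := @h4 x
        simp only [mem_inter, mem_union, mem_Icc] at *
        grind
      rw [this, h3]
  · intro F hF
    simp only [mem_filter, mem_powersetCard] at hF
    ext x
    have := @hF.1.1 x
    simp only [mem_inter, mem_union, mem_Icc] at *
    grind
  · intro P hP
    simp only [mem_product, mem_powersetCard] at hP
    obtain ⟨⟨h2, h3⟩, h4, h5⟩ := hP
    ext x <;>
    · have := @h2 x
      have := @h4 x
      simp only [mem_inter, mem_union, mem_Icc] at *
      grind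

end Counting

/-! ### Shifted cross intersecting families -/

/-- Frankl's lemma: the walks of members `F` and `G` of two shifted cross `t`-intersecting families
have, at some common time, heights that add up to at least `2 * t`. -/
lemma exists_prefixCard_add {n t : ℕ} {A B : Finset (Finset ℕ)} (hA : IsShifted n A)
    (hAB : CrossIntersecting t A B) {F G : Finset ℕ} (hF : F ∈ A) (hG : G ∈ B)
    (hFn : F ⊆ Icc 1 n) :
    ∃ i ≤ n, i + t ≤ prefixCard F i + prefixCard G i := by
  induction hm : #(F ∩ G) using Nat.strong_induction_on generalizing F with
  | _ m ih =>
  by_contra! hcon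
  have hsum : ∀ i, prefixCard F i + prefixCard G i =
      prefixCard (F ∩ G) i + prefixCard (F ∪ G) i := by
    intro i
    unfold prefixCard
    rw [← card_union_add_card_inter, add_comm]
    congr 2 <;> grind
  have hex : ∃ i, t ≤ prefixCard (F ∩ G) i :=
    ⟨n, by rw [prefixCard_eq_card (inter_subset_left.trans hFn)]; exact hAB F hF G hG⟩
  -- `i` is the position of the `t`-th common element of `F` and `G`.
  obtain ⟨i, hi, hmin⟩ : ∃ i, t ≤ prefixCard (F ∩ G) i ∧
      ∀ j < i, prefixCard (F ∩ G) j < t :=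
    ⟨Nat.find hex, Nat.find_spec hex, fun j hj => not_le.1 (Nat.find_min hex hj)⟩
  have hin : i ≤ n := by
    by_contra! h
    have := hmin n h
    rw [prefixCard_eq_card (inter_subset_left.trans hFn)] at this
    exact this.not_ge (hAB F hF G hG)
  have hlt := hcon i hin
  rw [hsum] at hlt
  obtain _ | i := i
  · simp at hi hlt
    omega
  have hprev := hmin i (by omega)
  have hmem : i + 1 ∈ F ∩ G := by
    by_contra h
    rw [prefixCard_succ, if_neg h] at hi
    omega
  -- `[i + 1]` is not covered by `F ∪ G`, so `i + 1` can be shifted to a gap `j`.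
  obtain ⟨j, hj, hjn⟩ : ∃ j ∈ Icc 1 (i + 1), j ∉ F ∪ G := by
    by_contra! h
    have : prefixCard (F ∪ G) (i + 1) = i + 1 := by
      rw [prefixCard, inter_eq_right.2 h]; simp
    omega
  rw [mem_Icc] at hj
  rw [mem_inter] at hmem
  rw [mem_union, not_or] at hjn
  have hji : j ≠ i + 1 := by rintro rfl; exact hjn.1 hmem.1
  have hF' : (F \ {i + 1}) ∪ {j} ∈ A := by
    refine hA j (i + 1) hj.1 (by omega) hin F hF ?_
    ext x
    simp only [mem_inter, mem_insert, mem_singleton]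
    grind
  obtain ⟨i', hi', h'⟩ := ih _ (by
    rw [← hm]
    refine card_lt_card ((ssubset_iff_of_subset ?_).2 ⟨i + 1, mem_inter.2 hmem, ?_⟩)
    · intro x; simp only [mem_inter, mem_union, mem_sdiff, mem_singleton]; grind
    · simp; grind) hF' (by
    intro x hx
    simp only [mem_union, mem_sdiff, mem_singleton] at hx
    rcases hx with hx | rfl
    · exact hFn hx.1
    · rw [mem_Icc]; omega) rfl
  have hc := hcon i' hi'
  by_cases hcase : j ≤ i' ∧ i' ≤ i
  · have h1 : prefixCard ((F \ {i + 1}) ∪ {j}) i' ≤ prefixCard F i' + 1 := by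
      unfold prefixCard
      refine (card_le_card (t := insert j (F ∩ Icc 1 i')) ?_).trans (card_insert_le _ _)
      intro x; simp only [mem_inter, mem_union, mem_sdiff, mem_singleton, mem_insert]; tauto
    have h2 := hmin i' (by omega)
    have h3 : prefixCard (F ∪ G) i' < i' := by
      have : (F ∪ G) ∩ Icc 1 i' ⊂ Icc 1 i' := by
        refine (ssubset_iff_of_subset inter_subset_right).2 ⟨j, mem_Icc.2 ⟨hj.1, hcase.1⟩, ?_⟩
        simp [hjn]
      simpa [prefixCard] using card_lt_card this
    have := hsum i'
    omega
  · have h1 : prefixCard ((F \ {i + 1}) ∪ {j}) i' ≤ prefixCard F i' := by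
      unfold prefixCard
      by_cases hle : i + 1 ≤ i'
      · refine (card_le_card (t := insert j ((F ∩ Icc 1 i').erase (i + 1))) ?_).trans
          ((card_insert_le _ _).trans ?_)
        · intro x; simp only [mem_inter, mem_union, mem_sdiff, mem_singleton, mem_insert, mem_erase]
          tauto
        · rw [card_erase_add_one]
          exact mem_inter.2 ⟨hmem.1, mem_Icc.2 ⟨by omega, hle⟩⟩
      · refine card_le_card fun x => ?_
        simp only [mem_inter, mem_union, mem_sdiff, mem_singleton, mem_Icc]
        grind
    omega

section Structure
open scoped Classical

/-! ### Levels of families -/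

lemma card_le_of_forall_reaches {n k l w : ℕ} {A : Finset (Finset ℕ)} (hn : k + l = n)
    (hkl : k ≤ l) (hA : IsUniformFamily n k A) (h : ∀ F ∈ A, Reaches n w F) :
    #A ≤ n.choose (l + w) :=
  (card_le_card fun F hF => mem_filter.2 ⟨hA hF, h F hF⟩).trans
    (card_reaches_le n k l w hn (by omega))

lemma card_le_of_forall_reachesTwice {n k l w : ℕ} {A : Finset (Finset ℕ)} (hn : k + l = n)
    (hkl : k ≤ l) (hn0 : 0 < n) (hA : IsUniformFamily n k A) (h : ∀ F ∈ A, ReachesTwice n w F) :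
    #A ≤ 2 * (n - 1).choose (l + w) := by
  obtain ⟨n, rfl⟩ : ∃ m, n = m + 1 := ⟨n - 1, by omega⟩
  exact (card_le_card fun F hF => mem_filter.2 ⟨hA hF, h F hF⟩).trans
    (card_reachesTwice_le n k l w hn (by omega))

/-- A nonempty family has a largest height that all its members reach. -/
lemma exists_level {n k : ℕ} {A : Finset (Finset ℕ)} (hA : IsUniformFamily n k A)
    (hne : A.Nonempty) {w₀ : ℕ} (h₀ : ∀ F ∈ A, Reaches n w₀ F) :
    ∃ w, w₀ ≤ w ∧ (∀ F ∈ A, Reaches n w F) ∧ ∃ F ∈ A, ¬ Reaches n (w + 1) F := by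
  have hex : ∃ d, ∃ F ∈ A, ¬ Reaches n (w₀ + d + 1) F := by
    obtain ⟨F, hF⟩ := hne
    refine ⟨k, F, hF, fun h => ?_⟩
    have := h.le_card
    rw [(mem_powersetCard.1 (hA hF)).2] at this
    omega
  refine ⟨w₀ + Nat.find hex, by omega, ?_, Nat.find_spec hex⟩
  rcases h : Nat.find hex with _ | d
  · simpa using h₀
  · have := Nat.find_min hex (m := d) (by omega)
    push Not at this
    exact this

/-- The walk of `F` is at height at least `w` at time `T`, and at no other time up to `n`. -/
def ReachesOnlyAt (n w T : ℕ) (F : Finset ℕ) : Prop :=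
  T ≤ n ∧ T + w ≤ 2 * prefixCard F T ∧ ∀ i ≤ n, i ≠ T → 2 * prefixCard F i < i + w

lemma Reaches.exists_onlyAt {n w : ℕ} {F : Finset ℕ} (h : Reaches n w F)
    (h' : ¬ ReachesTwice n w F) : ∃ T, ReachesOnlyAt n w T F := by
  obtain ⟨T, hT, h⟩ := h
  refine ⟨T, hT, h, fun i hi hiT => ?_⟩
  by_contra! hc
  rcases lt_or_gt_of_ne hiT with hlt | hlt
  · exact h' ⟨T, hT, i, hlt, hc, h⟩
  · exact h' ⟨i, hi, T, hlt, h, hc⟩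

lemma ReachesOnlyAt.not_reaches_succ {n w T : ℕ} {F : Finset ℕ} (h : ReachesOnlyAt n w T F) :
    ¬ Reaches n (w + 1) F := by
  intro hr
  obtain ⟨j, hj, i, hi, h1, h2⟩ := hr.reachesTwice
  have h3 := h.2.2 i (by omega)
  have h4 := h.2.2 j hj
  omega

lemma ReachesOnlyAt.two_mul_prefixCard {n w T : ℕ} {F : Finset ℕ} (h : ReachesOnlyAt n w T F) :
    2 * prefixCard F T = T + w := by
  have h1 := h.2.1
  by_contra hne
  exact h.not_reaches_succ ⟨T, h.1, by omega⟩

/-- The sets in `([n] choose k)` that miss at most `s` elements of `[T]`. -/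
def prefixFamily (n k T s : ℕ) : Finset (Finset ℕ) :=
  {F ∈ powersetCard k (Icc 1 n) | T ≤ prefixCard F T + s}

lemma franklFamily_zero (t n k : ℕ) : franklFamily 0 t n k = prefixFamily n k t 0 := by
  simp [franklFamily, prefixFamily, prefixCard]

lemma card_filter_misses {n k l T s : ℕ} (hn : k + l = n) (hT : T ≤ n) (hsT : s ≤ T)
    (hsl : s ≤ l) :
    #{F ∈ powersetCard k (Icc 1 n) | prefixCard F T + s = T} =
      T.choose s * (n - T).choose (l - s) := by
  have h : ∀ F, prefixCard F T + s = T ↔ prefixCard F T = T - s := fun F => by omega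
  simp only [h]
  by_cases hk : T - s ≤ k
  · rw [card_filter_prefixCard_eq n k T _ hT hk, Nat.choose_symm hsT]
    congr 1
    exact Nat.choose_symm_of_eq_add (by omega)
  · rw [Nat.choose_eq_zero_of_lt (n := n - T) (by omega), mul_zero, card_eq_zero,
      filter_eq_empty_iff]
    intro F hF hc
    have := prefixCard_le_card F T
    rw [(mem_powersetCard.1 hF).2] at this
    omega

lemma card_prefixFamily_zero {n k l T : ℕ} (hn : k + l = n) (hT : T ≤ n) :
    #(prefixFamily n k T 0) = (n - T).choose l := by
  have h := card_filter_misses (s := 0) hn hT (by omega) (by omega)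
  rw [Nat.choose_zero_right, one_mul, Nat.sub_zero] at h
  rw [← h, prefixFamily]
  congr 1
  refine filter_congr fun F _ => ?_
  have := prefixCard_le_self F T
  omega

lemma card_prefixFamily_one {n k l T : ℕ} (hn : k + l = n) (hT : T ≤ n) (hT1 : 1 ≤ T)
    (hl : 1 ≤ l) :
    #(prefixFamily n k T 1) = T * (n - T).choose (l - 1) + (n - T).choose l := by
  have h := card_filter_misses (s := 0) hn hT (by omega) (by omega)
  have h' := card_filter_misses (s := 1) hn hT (by omega) (by omega)
  rw [Nat.choose_zero_right, one_mul, Nat.sub_zero] at h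
  rw [Nat.choose_one_right] at h'
  rw [← h, ← h', prefixFamily, ← card_union_of_disjoint, ← filter_or]
  · congr 1
    refine filter_congr fun F _ => ?_
    have := prefixCard_le_self F T
    omega
  · rw [disjoint_filter]
    intros
    omega

lemma choose_mul_choose_le_card_prefixFamily {n k l T s : ℕ} (hn : k + l = n) (hT : T ≤ n)
    (hsT : s ≤ T) (hsl : s ≤ l) :
    T.choose s * (n - T).choose (l - s) ≤ #(prefixFamily n k T s) := by
  rw [← card_filter_misses hn hT hsT hsl]
  exact card_le_card (monotone_filter_right _ fun F _ h => h.ge)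

/-- Either the product of the sizes is controlled by the reflection bounds alone, or both families
have members that are at their extreme heights `u` and `v` at a single time `T`, which is then
common to all these members. Here `s` and `s'` are the numbers of down-steps up to time `T`. -/
lemma level_trichotomy {n k l t : ℕ} {A B : Finset (Finset ℕ)} (hn : k + l = n) (hkl : k ≤ l)
    (hk : 0 < k) (ht : 0 < t)
    (hA : IsUniformFamily n k A) (hB : IsUniformFamily n k B) (hAs : IsShifted n A)
    (hAB : CrossIntersecting t A B) (hAne : A.Nonempty) (hBne : B.Nonempty) :
    ∃ u v, #A ≤ n.choose (l + u) ∧ #B ≤ n.choose (l + v) ∧ (2 * t + 1 ≤ u + v ∨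
      u + v = 2 * t ∧ (#A ≤ 2 * (n - 1).choose (l + u) ∨ #B ≤ 2 * (n - 1).choose (l + v) ∨
        ∃ T s s', T = t + s + s' ∧ T = u + 2 * s ∧ T = v + 2 * s' ∧ T ≤ n ∧ T ≤ k + s ∧
          T ≤ k + s' ∧ 1 ≤ u ∧ 1 ≤ v ∧
          (∀ F ∈ A, Reaches n (u + 1) F ∨ T ≤ prefixCard F T + s) ∧
          (∀ G ∈ B, Reaches n (v + 1) G ∨ T ≤ prefixCard G T + s'))) := by
  obtain ⟨u, -, hu, F₀, hF₀, hF₀u⟩ := exists_level hA hAne (w₀ := 0) fun F _ => reaches_zero n F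
  obtain ⟨v, -, hv, G₀, hG₀, hG₀v⟩ := exists_level hB hBne (w₀ := 0) fun F _ => reaches_zero n F
  have hsum : ∀ F ∈ A, ∀ G ∈ B, ∃ i ≤ n, i + t ≤ prefixCard F i + prefixCard G i :=
    fun F hF G hG => exists_prefixCard_add hAs hAB hF hG (mem_powersetCard.1 (hA hF)).1
  refine ⟨u, v, card_le_of_forall_reaches hn hkl hA hu, card_le_of_forall_reaches hn hkl hB hv, ?_⟩
  have huv : 2 * t ≤ u + v := by
    obtain ⟨i, hi, h⟩ := hsum F₀ hF₀ G₀ hG₀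
    by_contra! hc
    have h1 : ¬ (i + (u + 1) ≤ 2 * prefixCard F₀ i) := fun h' => hF₀u ⟨i, hi, h'⟩
    have h2 : ¬ (i + (v + 1) ≤ 2 * prefixCard G₀ i) := fun h' => hG₀v ⟨i, hi, h'⟩
    omega
  rcases huv.eq_or_lt with huv | huv
  swap
  · exact Or.inl huv
  refine Or.inr ⟨huv.symm, ?_⟩
  by_cases hA2 : ∀ F ∈ A, ReachesTwice n u F
  · exact Or.inl (card_le_of_forall_reachesTwice hn hkl (by omega) hA hA2)
  by_cases hB2 : ∀ G ∈ B, ReachesTwice n v G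
  · exact Or.inr (Or.inl (card_le_of_forall_reachesTwice hn hkl (by omega) hB hB2))
  refine Or.inr (Or.inr ?_)
  push Not at hA2 hB2
  obtain ⟨F₁, hF₁, h1⟩ := hA2
  obtain ⟨G₁, hG₁, h2⟩ := hB2
  obtain ⟨T, hT⟩ := (hu F₁ hF₁).exists_onlyAt h1
  obtain ⟨T', hT'⟩ := (hv G₁ hG₁).exists_onlyAt h2
  have hFT : ∀ F ∈ A, Reaches n (u + 1) F ∨ T' + u ≤ 2 * prefixCard F T' := by
    intro F hF
    obtain ⟨i, hi, h⟩ := hsum F hF G₁ hG₁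
    by_cases hiT : i = T'
    · subst hiT
      have := hT'.two_mul_prefixCard
      right; omega
    · have := hT'.2.2 i hi hiT
      exact Or.inl ⟨i, hi, by omega⟩
  have hGT : ∀ G ∈ B, Reaches n (v + 1) G ∨ T + v ≤ 2 * prefixCard G T := by
    intro G hG
    obtain ⟨i, hi, h⟩ := hsum F₁ hF₁ G hG
    by_cases hiT : i = T
    · subst hiT
      have := hT.two_mul_prefixCard
      right; omega
    · have := hT.2.2 i hi hiT
      exact Or.inl ⟨i, hi, by omega⟩
  obtain rfl : T' = T := by
    by_contra hne
    rcases hFT F₁ hF₁ with h | h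
    · exact hT.not_reaches_succ h
    · have := hT.2.2 T' hT'.1 hne
      omega
  have e1 := hT.two_mul_prefixCard
  have e2 := hT'.two_mul_prefixCard
  have l1 := prefixCard_le_self F₁ T'
  have l2 := prefixCard_le_self G₁ T'
  have c1 := prefixCard_le_card F₁ T'
  have c2 := prefixCard_le_card G₁ T'
  rw [(mem_powersetCard.1 (hA hF₁)).2] at c1
  rw [(mem_powersetCard.1 (hB hG₁)).2] at c2
  -- Every walk is at height `0` at time `0`, so the heights of a single visit are positive.
  have p1 : u ≠ 0 := by
    rintro rfl
    have := hT.2.2 0 (by omega) (by omega)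
    simp at this
  have p2 : v ≠ 0 := by
    rintro rfl
    have := hT'.2.2 0 (by omega) (by omega)
    simp at this
  refine ⟨T', T' - prefixCard F₁ T', T' - prefixCard G₁ T', by omega, by omega, by omega, hT.1,
    by omega, by omega, by omega, by omega, fun F hF => ?_, fun G hG => ?_⟩
  · refine (hFT F hF).imp_right fun h => ?_
    omega
  · refine (hGT G hG).imp_right fun h => ?_
    omega

/-- A walk that stays below height `u + 1` but is at least as high as `u` at time `T` is exactly at
height `u` then. -/
lemma card_le_of_forall_reaches_or {n k l T u s : ℕ} {A : Finset (Finset ℕ)} (hn : k + l = n)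
    (hkl : k ≤ l) (hA : IsUniformFamily n k A) (hT : T ≤ n) (hTu : T = u + 2 * s) (hsl : s ≤ l)
    (h : ∀ F ∈ A, Reaches n (u + 1) F ∨ T ≤ prefixCard F T + s) :
    #A ≤ n.choose (l + (u + 1)) + T.choose s * (n - T).choose (l - s) := by
  rw [← card_filter_misses hn hT (by omega) hsl]
  refine (card_le_card (t := {F ∈ powersetCard k (Icc 1 n) | Reaches n (u + 1) F} ∪
    {F ∈ powersetCard k (Icc 1 n) | prefixCard F T + s = T}) fun F hF => ?_).trans
    ((card_union_le _ _).trans (add_le_add (card_reaches_le n k l _ hn (by omega)) le_rfl))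
  rw [mem_union, mem_filter, mem_filter]
  by_cases hr : Reaches n (u + 1) F
  · exact Or.inl ⟨hA hF, hr⟩
  · refine Or.inr ⟨hA hF, ?_⟩
    have h1 := (h F hF).resolve_left hr
    by_contra hne
    exact hr ⟨T, hT, by omega⟩

/-! ### Members lost to a member outside the extremal family -/

/-- The set that contains `[T]` up to `Z`, misses the next `m` elements, and continues as `V`. -/
def glue (T m : ℕ) (Z V : Finset ℕ) : Finset ℕ :=
  (Icc 1 T \ Z) ∪ V.map (addRightEmbedding (T + m))

lemma mem_glue {T m : ℕ} {Z V : Finset ℕ} {x : ℕ} :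
    x ∈ glue T m Z V ↔ (x ∈ Icc 1 T ∧ x ∉ Z) ∨ ∃ y ∈ V, y + (T + m) = x := by
  simp [glue]

lemma prefixCard_glue_le {t T m i : ℕ} {Z V : Finset ℕ} (hZ : Z ⊆ Icc 1 t) (hti : t ≤ i)
    (hiT : i ≤ T) (hV : 0 ∉ V) : prefixCard (glue T m Z V) i + #Z ≤ i := by
  have h : glue T m Z V ∩ Icc 1 i ⊆ Icc 1 i \ Z := by
    intro x
    simp only [mem_inter, mem_glue, mem_sdiff, mem_Icc]
    rintro ⟨h | ⟨y, hy, rfl⟩, h'⟩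
    · exact ⟨h', h.2⟩
    · have : y ≠ 0 := by rintro rfl; exact hV hy
      omega
  have h1 := card_le_card h
  rw [card_sdiff_of_subset (hZ.trans (Icc_subset_Icc_right hti)), Nat.card_Icc] at h1
  have h2 := card_le_card (hZ.trans (Icc_subset_Icc_right hti))
  rw [Nat.card_Icc] at h2
  unfold prefixCard
  omega

lemma prefixCard_glue_add_le {t T m j : ℕ} {Z V : Finset ℕ} (hZ : Z ⊆ Icc 1 t) (htT : t ≤ T)
    (hV : 0 ∉ V) :
    prefixCard (glue T m Z V) (T + m + j) + #Z ≤ T + prefixCard V j := by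
  have h : glue T m Z V ∩ Icc 1 (T + m + j) ⊆
      (Icc 1 T \ Z) ∪ (V ∩ Icc 1 j).map (addRightEmbedding (T + m)) := by
    intro x
    simp only [mem_inter, mem_glue, mem_union, mem_sdiff, mem_Icc, mem_map,
      addRightEmbedding_apply]
    rintro ⟨h | ⟨y, hy, rfl⟩, h'⟩
    · exact Or.inl h
    · have : y ≠ 0 := by rintro rfl; exact hV hy
      exact Or.inr ⟨y, ⟨hy, by omega⟩, rfl⟩
  have h1 := (card_le_card h).trans (card_union_le _ _)
  rw [card_sdiff_of_subset (hZ.trans (Icc_subset_Icc_right htT)), Nat.card_Icc, card_map] at h1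
  have h2 := card_le_card (hZ.trans (Icc_subset_Icc_right htT))
  rw [Nat.card_Icc] at h2
  unfold prefixCard
  omega

lemma glue_injOn {t T m N : ℕ} (htT : t ≤ T) :
    Set.InjOn (fun P : Finset ℕ × Finset ℕ => glue T m P.1 P.2)
      {P | P.1 ⊆ Icc 1 t ∧ P.2 ⊆ Icc 1 N} := by
  rintro ⟨Z, V⟩ ⟨hZ, hV⟩ ⟨Z', V'⟩ ⟨hZ', hV'⟩ h
  simp only at h hZ hV hZ' hV'
  have key := fun x => Finset.ext_iff.1 h x
  simp only [mem_glue, mem_Icc] at key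
  simp only [Prod.mk.injEq]
  constructor
  · ext x
    have k1 := key x
    have a1 := @hZ x
    have a2 := @hZ' x
    simp only [mem_Icc] at a1 a2
    have b1 : ∀ y ∈ V, y + (T + m) = x → T < x := fun y hy e => by
      have := hV hy; rw [mem_Icc] at this; omega
    have b2 : ∀ y ∈ V', y + (T + m) = x → T < x := fun y hy e => by
      have := hV' hy; rw [mem_Icc] at this; omega
    grind
  · ext x
    have k1 := key (x + (T + m))
    have a1 := @hV x
    have a2 := @hV' x
    simp only [mem_Icc] at a1 a2
    grind

lemma card_glue {t T m N : ℕ} {Z V : Finset ℕ} (hZ : Z ⊆ Icc 1 t) (htT : t ≤ T)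
    (hV : V ⊆ Icc 1 N) : #(glue T m Z V) = T - #Z + #V := by
  rw [glue, card_union_of_disjoint, card_sdiff_of_subset (hZ.trans (Icc_subset_Icc_right htT)),
    card_map, Nat.card_Icc, Nat.add_sub_cancel]
  rw [disjoint_left]
  intro x hx
  simp only [mem_map, addRightEmbedding_apply, not_exists, not_and]
  intro y hy e
  have := hV hy
  simp only [mem_sdiff, mem_Icc] at hx this
  omega

/-- A member `F` of `A` that misses more than `s` elements of `[T]` and stays below height
`u + r + 2` excludes from `B` every set that misses just `s'` elements of `[T]`, all of them in
`[t]`, then takes `r + 3` down-steps, and climbs at most one step from there. -/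
lemma choose_mul_le_card_sdiff {n k l t T s s' u r : ℕ} {A B : Finset (Finset ℕ)}
    (hn : k + l = n) (hA : IsUniformFamily n k A) (hAs : IsShifted n A)
    (hAB : CrossIntersecting t A B)
    (hT : T = t + s + s') (hTu : T = u + 2 * s) (hTk : T ≤ k + s')
    (hkl' : k + (r + 3) + s' ≤ l) (hs't : s' ≤ t)
    {F : Finset ℕ} (hF : F ∈ A) (hFT : prefixCard F T + s < T)
    (hFr : ¬ Reaches n (u + r + 2) F) :
    t.choose s' * ((n - T - (r + 3)).choose (l - s' - (r + 3)) -
        (n - T - (r + 3)).choose (l - s' - (r + 3) + 2)) ≤ #(prefixFamily n k T s' \ B) := by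
  set N := n - T - (r + 3) with hN
  set K := k + s' - T with hK
  have hNK : N = K + (l - s' - (r + 3)) := by omega
  set W : Finset (Finset ℕ) := {V ∈ powersetCard K (Icc 1 N) | ¬ Reaches N 2 V} with hW
  have hWc : N.choose (l - s' - (r + 3)) - N.choose (l - s' - (r + 3) + 2) ≤ #W := by
    have h1 := card_reaches_le N K (l - s' - (r + 3)) 2 hNK.symm (by omega)
    have h2 : #{V ∈ powersetCard K (Icc 1 N) | Reaches N 2 V} + #W = N.choose K := by
      rw [hW, card_filter_add_card_filter_not, card_powersetCard, Nat.card_Icc, Nat.add_sub_cancel]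
    rw [Nat.choose_symm_of_eq_add hNK] at h2
    omega
  have hprod : #(powersetCard s' (Icc 1 t) ×ˢ W) = t.choose s' * #W := by
    rw [card_product, card_powersetCard, Nat.card_Icc, Nat.add_sub_cancel]
  refine (Nat.mul_le_mul_left _ hWc).trans ?_
  rw [← hprod]
  refine card_le_card_of_injOn (fun P => glue T (r + 3) P.1 P.2) ?_
    ((glue_injOn (t := t) (T := T) (m := r + 3) (N := N) (by omega)).mono ?_)
  swap
  · rintro ⟨Z, V⟩ h
    simp only [coe_product, Set.mem_prod, mem_coe, hW, mem_filter, mem_powersetCard] at h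
    exact ⟨h.1.1, h.2.1.1⟩
  rintro ⟨Z, V⟩ h
  simp only [coe_product, Set.mem_prod, mem_coe, hW, mem_filter, mem_powersetCard] at h
  obtain ⟨⟨hZ, hZc⟩, ⟨hV, hVc⟩, hVr⟩ := h
  have hV0 : 0 ∉ V := fun h0 => by have := hV h0; rw [mem_Icc] at this; omega
  have hsub : glue T (r + 3) Z V ⊆ Icc 1 n := by
    intro x hx
    rw [mem_glue] at hx
    rw [mem_Icc]
    rcases hx with ⟨hx, -⟩ | ⟨y, hy, rfl⟩
    · rw [mem_Icc] at hx; omega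
    · have := hV hy; rw [mem_Icc] at this; omega
  simp only [mem_coe, mem_sdiff, prefixFamily, mem_filter, mem_powersetCard]
  refine ⟨⟨⟨hsub, ?_⟩, ?_⟩, fun hmem => ?_⟩
  · rw [card_glue hZ (by omega) hV]; omega
  · have h1 : Icc 1 T \ Z ⊆ glue T (r + 3) Z V ∩ Icc 1 T := by
      intro x
      simp only [mem_inter, mem_glue, mem_sdiff]
      tauto
    have h2 := card_le_card h1
    rw [card_sdiff_of_subset (hZ.trans (Icc_subset_Icc_right (by omega))), Nat.card_Icc] at h2
    unfold prefixCard
    omega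
  · obtain ⟨i, hi, h⟩ := exists_prefixCard_add hAs hAB hF hmem (mem_powersetCard.1 (hA hF)).1
    have hFi : 2 * prefixCard F i < i + (u + r + 2) := by
      by_contra! hc
      exact hFr ⟨i, hi, hc⟩
    have s1 := prefixCard_le_self F i
    have s2 := prefixCard_le_self (glue T (r + 3) Z V) i
    rcases lt_or_ge i t with hit | hit
    · omega
    rcases le_or_gt i T with hiT | hiT
    · have h1 := prefixCard_glue_le (m := r + 3) (V := V) hZ hit hiT hV0
      have h2 := prefixCard_mono F hiT
      omega
    rcases le_or_gt i (T + (r + 3)) with hiT' | hiT'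
    · have h1 := prefixCard_glue_add_le (m := r + 3) (j := 0) hZ (show t ≤ T by omega) hV0
      have h2 := prefixCard_mono (glue T (r + 3) Z V) hiT'
      have h3 := prefixCard_add_le F T (i - T)
      rw [show T + (i - T) = i by omega] at h3
      simp at h1
      omega
    · obtain ⟨j, rfl⟩ : ∃ j, i = T + (r + 3) + j := ⟨i - (T + (r + 3)), by omega⟩
      have h1 := prefixCard_glue_add_le (m := r + 3) (j := j) hZ (show t ≤ T by omega) hV0
      have h2 : ¬ (j + 2 ≤ 2 * prefixCard V j) := fun hc => hVr ⟨j, by omega, hc⟩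
      omega

end Structure

/-! ### Estimates for binomial coefficients -/

lemma choose_mul_choose_succ_le (n i j : ℕ) (h : i ≤ j) :
    n.choose i * n.choose (j + 1) ≤ n.choose (i + 1) * n.choose j := by
  have h1 := Nat.choose_succ_right_eq n i
  have h2 := Nat.choose_succ_right_eq n j
  refine le_of_mul_le_mul_right ?_ (show 0 < (i + 1) * (j + 1) by positivity)
  calc n.choose i * n.choose (j + 1) * ((i + 1) * (j + 1))
      = n.choose i * (n.choose (j + 1) * (j + 1)) * (i + 1) := by ring
    _ = n.choose i * n.choose j * ((n - j) * (i + 1)) := by rw [h2]; ring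
    _ ≤ n.choose i * n.choose j * ((n - i) * (j + 1)) := by gcongr
    _ = (n.choose (i + 1) * (i + 1)) * n.choose j * (j + 1) := by rw [h1]; ring
    _ = n.choose (i + 1) * n.choose j * ((i + 1) * (j + 1)) := by ring

/-- Log-concavity of a row of Pascal's triangle. -/
lemma choose_mul_choose_le (n i d e : ℕ) :
    n.choose i * n.choose (i + 2 * d + e) ≤ n.choose (i + d) * n.choose (i + d + e) := by
  induction d generalizing i with
  | zero => simp
  | succ d ih =>
    have h1 := choose_mul_choose_succ_le n i (i + 2 * d + e + 1) (by omega)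
    have h2 := ih (i + 1)
    rw [show i + 1 + 2 * d + e = i + 2 * d + e + 1 by omega,
      show i + 1 + d = i + (d + 1) by omega] at h2
    rw [show i + 2 * (d + 1) + e = i + 2 * d + e + 1 + 1 by omega]
    exact h1.trans h2

lemma choose_sub_le (N l s : ℕ) (hs : s ≤ l) (hN : s ≤ N) :
    (N - s).choose (l - s) ≤ N.choose l := by
  induction s with
  | zero => simp
  | succ s ih =>
    refine le_trans ?_ (ih (by omega) (by omega))
    rw [show N - s = N - (s + 1) + 1 by omega, show l - s = l - (s + 1) + 1 by omega,
      Nat.choose_succ_succ']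
    omega

lemma choose_succ_mul_le {t k l n : ℕ} (hk : 0 < k) (hl : t * k ≤ l) (hn : k + l = n) (j : ℕ) :
    n.choose (l + (j + 1)) * t ≤ n.choose (l + j) := by
  have h := Nat.choose_succ_right_eq n (l + j)
  refine le_of_mul_le_mul_right ?_ hk
  calc n.choose (l + (j + 1)) * t * k = n.choose (l + (j + 1)) * (t * k) := by ring
    _ ≤ n.choose (l + j + 1) * (l + j + 1) := Nat.mul_le_mul le_rfl (by omega)
    _ = n.choose (l + j) * (n - (l + j)) := h
    _ ≤ n.choose (l + j) * k := Nat.mul_le_mul le_rfl (by omega)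

lemma choose_add_mul_pow_le {t k l n : ℕ} (hk : 0 < k) (hl : t * k ≤ l) (hn : k + l = n)
    (j d : ℕ) : n.choose (l + (j + d)) * t ^ d ≤ n.choose (l + j) := by
  induction d with
  | zero => simp
  | succ d ih =>
    refine le_trans ?_ ih
    rw [pow_succ', ← mul_assoc]
    exact Nat.mul_le_mul_right _ (choose_succ_mul_le hk hl hn (j + d))

lemma choose_antitone {t k l n : ℕ} (ht : 0 < t) (hk : 0 < k) (hl : t * k ≤ l) (hn : k + l = n)
    {i j : ℕ} (hij : i ≤ j) : n.choose (l + j) ≤ n.choose (l + i) := by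
  obtain ⟨d, rfl⟩ := Nat.exists_eq_add_of_le hij
  exact (Nat.le_mul_of_pos_right _ (by positivity)).trans (choose_add_mul_pow_le hk hl hn i d)

lemma choose_mul_choose_mul_le {t k l n u v : ℕ} (ht : 0 < t) (hk : 0 < k) (hl : t * k ≤ l)
    (hn : k + l = n) (huv : 2 * t + 1 ≤ u + v) :
    n.choose (l + u) * n.choose (l + v) * t ≤ n.choose (l + t) ^ 2 := by
  wlog h : u ≤ v generalizing u v
  · rw [mul_comm (n.choose (l + u))]
    exact this (by omega) (by omega)
  have h1 : n.choose (l + u) * n.choose (l + v) ≤ n.choose (l + t) * n.choose (l + (t + 1)) := by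
    rcases le_or_gt t u with htu | htu
    · exact Nat.mul_le_mul (choose_antitone ht hk hl hn htu)
        (choose_antitone ht hk hl hn (by omega))
    · have h2 := choose_mul_choose_le n (l + u) (t - u) 1
      have h3 := choose_antitone ht hk hl hn (show 2 * t + 1 - u ≤ v by omega)
      rw [show l + u + 2 * (t - u) + 1 = l + (2 * t + 1 - u) by omega,
        show l + u + (t - u) = l + t by omega] at h2
      exact (Nat.mul_le_mul le_rfl h3).trans h2
  calc _ ≤ n.choose (l + t) * n.choose (l + (t + 1)) * t := Nat.mul_le_mul_right _ h1
    _ = n.choose (l + t) * (n.choose (l + (t + 1)) * t) := by ring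
    _ ≤ n.choose (l + t) * n.choose (l + t) :=
      Nat.mul_le_mul le_rfl (choose_succ_mul_le hk hl hn t)
    _ = _ := by ring

lemma choose_mul_choose_le_sq {l n u v t : ℕ} (huv : u + v = 2 * t) :
    n.choose (l + u) * n.choose (l + v) ≤ n.choose (l + t) ^ 2 := by
  wlog h : u ≤ v generalizing u v
  · rw [mul_comm]
    exact this (by omega) (by omega)
  have h2 := choose_mul_choose_le n (l + u) (t - u) 0
  rw [show l + u + 2 * (t - u) + 0 = l + v by omega,
    show l + u + (t - u) = l + t by omega] at h2
  rw [sq]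
  exact h2

lemma choose_pred_mul_le {t k l n : ℕ} (hk : 0 < k) (hl : t * k ≤ l) (hn : k + l = n) (j : ℕ) :
    (n - 1).choose (l + j) * (t + 1) ≤ n.choose (l + j) := by
  obtain ⟨m, rfl⟩ : ∃ m, n = m + 1 := ⟨n - 1, by omega⟩
  have h := Nat.choose_mul_succ_eq m (l + j)
  refine le_of_mul_le_mul_right ?_ hk
  calc m.choose (l + j) * (t + 1) * k = m.choose (l + j) * (t * k + k) := by ring
    _ ≤ m.choose (l + j) * (m + 1) := Nat.mul_le_mul le_rfl (by omega)
    _ = (m + 1).choose (l + j) * (m + 1 - (l + j)) := h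
    _ ≤ (m + 1).choose (l + j) * k := Nat.mul_le_mul le_rfl (by omega)

/-- The total reflection bound at height `t` exceeds the size of the family of all sets that
contain `[t]` by less than the factor `e`. -/
lemma choose_add_le_mul {t K l : ℕ} (ht : 0 < t) (hl : t * (K + t) ≤ l) :
    ((K + t + l).choose (l + t) : ℝ) ≤ 2.719 * ((K + l).choose l : ℝ) := by
  have h1 : ∀ i ≤ t, (K + l + i).choose (l + i) * l ^ i ≤ (K + t + l) ^ i * (K + l).choose l := by
    intro i
    induction i with
    | zero => simp
    | succ i ih =>
      intro hi
      have h := Nat.add_one_mul_choose_eq (K + l + i) (l + i)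
      calc (K + l + (i + 1)).choose (l + (i + 1)) * l ^ (i + 1)
          = (K + l + i + 1).choose (l + i + 1) * l * l ^ i := by rw [pow_succ']; ring_nf
        _ ≤ (K + l + i + 1).choose (l + i + 1) * (l + i + 1) * l ^ i := by gcongr; omega
        _ = (K + l + i + 1) * ((K + l + i).choose (l + i) * l ^ i) := by rw [← h]; ring
        _ ≤ (K + t + l) * ((K + t + l) ^ i * (K + l).choose l) :=
          Nat.mul_le_mul (by omega) (ih (by omega))
        _ = _ := by ring
  have h2 := h1 t le_rfl
  have hl0 : 0 < l := lt_of_lt_of_le (by positivity) hl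
  have h3 : ((K + t + l : ℕ) : ℝ) ^ t ≤ 2.719 * (l : ℝ) ^ t := by
    have h4 : ((K + t + l : ℕ) : ℝ) ≤ Real.exp (1 / t) * l := by
      have h5 : (1 : ℝ) / t + 1 ≤ Real.exp (1 / t) := Real.add_one_le_exp _
      have h6 : ((K + t : ℕ) : ℝ) ≤ 1 / t * l := by
        rw [one_div, inv_mul_eq_div, le_div_iff₀ (by positivity), mul_comm]
        exact_mod_cast hl
      push_cast at h6 ⊢
      nlinarith [(Nat.cast_nonneg l : (0 : ℝ) ≤ l)]
    calc ((K + t + l : ℕ) : ℝ) ^ t ≤ (Real.exp (1 / t) * l) ^ t := by gcongr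
      _ = Real.exp 1 * (l : ℝ) ^ t := by
        rw [mul_pow, ← Real.exp_nat_mul, mul_one_div_cancel (by positivity)]
      _ ≤ _ := by gcongr; linarith [Real.exp_one_lt_d9]
  have hlt : (0 : ℝ) < (l : ℝ) ^ t := by positivity
  refine le_of_mul_le_mul_right ?_ hlt
  have h2' : ((K + t + l).choose (l + t) : ℝ) * (l : ℝ) ^ t ≤
      ((K + t + l : ℕ) : ℝ) ^ t * ((K + l).choose l : ℝ) := by
    rw [show K + t + l = K + l + t by omega] at h2 ⊢
    exact_mod_cast h2
  nlinarith [(Nat.cast_nonneg ((K + l).choose l) : (0 : ℝ) ≤ ((K + l).choose l : ℝ))]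

lemma pow_mul_choose_sub_le {t K l : ℕ} (hl0 : 0 < l) (hl : t * K ≤ l) (i : ℕ) :
    (t + 1) ^ i * (K + l - i).choose l ≤ (K + l).choose l := by
  induction i with
  | zero => simp
  | succ i ih =>
    refine le_trans ?_ ih
    rw [pow_succ, mul_assoc]
    refine Nat.mul_le_mul le_rfl ?_
    rcases le_or_gt K i with hi | hi
    · rw [Nat.choose_eq_zero_of_lt (by omega)]; simp
    · have h := Nat.choose_mul_succ_eq (K + l - (i + 1)) l
      rw [show K + l - (i + 1) + 1 = K + l - i by omega] at h
      refine le_of_mul_le_mul_right ?_ (show 0 < K + l - i by omega)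
      have h2 : (t + 1) * (K + l - i - l) ≤ K + l - i := by
        rw [show K + l - i - l = K - i by omega]
        have : t * (K - i) ≤ l := (Nat.mul_le_mul le_rfl (by omega)).trans hl
        rw [add_mul, one_mul]
        omega
      calc (t + 1) * (K + l - (i + 1)).choose l * (K + l - i)
          = (t + 1) * ((K + l - (i + 1)).choose l * (K + l - i)) := by ring
        _ = (K + l - i).choose l * ((t + 1) * (K + l - i - l)) := by rw [h]; ring
        _ ≤ _ := Nat.mul_le_mul le_rfl h2

/-- Lowering a height by one and shortening the remaining walk by one up-step decreases the product
of the two counts. -/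
lemma choose_mul_choose_exchange {t K l s d : ℕ} (ht : 0 < t) (hl : t * (K + t) ≤ l) (hd : 1 ≤ d)
    (hdt : d ≤ t) :
    (K + t + l).choose (l + (t - d)) * (K + l - s - (d + 1)).choose l ≤
      (K + t + l).choose (l + (t + 1 - d)) * (K + l - s - d).choose l := by
  have hl0 : 0 < l := lt_of_lt_of_le (by positivity) hl
  rcases le_or_gt K (s + d) with hK | hK
  · rw [Nat.choose_eq_zero_of_lt (n := K + l - s - (d + 1)) (by omega)]
    simp
  obtain ⟨W, rfl⟩ : ∃ W, K = s + d + W + 1 := ⟨K - s - d - 1, by omega⟩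
  have h1 := Nat.choose_mul_succ_eq (W + l) l
  have h2 := Nat.choose_succ_right_eq (s + d + W + 1 + t + l) (l + (t - d))
  rw [show W + l + 1 - l = W + 1 by omega] at h1
  rw [show s + d + W + 1 + t + l - (l + (t - d)) = s + 2 * d + W + 1 by omega] at h2
  rw [show s + d + W + 1 + l - s - (d + 1) = W + l by omega,
    show s + d + W + 1 + l - s - d = W + l + 1 by omega,
    show l + (t + 1 - d) = l + (t - d) + 1 by omega]
  set g := (s + d + W + 1 + t + l).choose (l + (t - d))
  set g' := (s + d + W + 1 + t + l).choose (l + (t - d) + 1)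
  refine le_of_mul_le_mul_right ?_ (show 0 < (s + 2 * d + W + 1) * (W + l + 1) by positivity)
  have key : (l + (t - d) + 1) * (W + 1) ≤ (s + 2 * d + W + 1) * (W + l + 1) := by
    have h3 : l + (t - d) + 1 ≤ l + t := by omega
    have h4 : t * (W + 1) ≤ l := (Nat.mul_le_mul le_rfl (by omega)).trans hl
    calc (l + (t - d) + 1) * (W + 1) ≤ (l + t) * (W + 1) := Nat.mul_le_mul_right _ h3
      _ = l * (W + 1) + t * (W + 1) := by ring
      _ ≤ l * (W + 1) + l := by omega
      _ ≤ l * (s + 2 * d + W + 1) := by nlinarith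
      _ ≤ _ := by nlinarith
  calc g * (W + l).choose l * ((s + 2 * d + W + 1) * (W + l + 1))
      = (g * (s + 2 * d + W + 1)) * ((W + l).choose l * (W + l + 1)) := by ring
    _ = g' * (W + l + 1).choose l * ((l + (t - d) + 1) * (W + 1)) := by rw [← h2, h1]; ring
    _ ≤ _ := Nat.mul_le_mul le_rfl key

lemma choose_mul_choose_sub_le {t K l : ℕ} (ht : 0 < t) (hl : t * (K + t) ≤ l) (s d : ℕ)
    (hdt : d ≤ t) :
    ((K + t + l).choose (l + (t + 1 - d)) : ℝ) * ((K + l - s - d).choose l : ℝ) *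
      (t * (t + 1) ^ s) ≤ 2.719 * ((K + l).choose l : ℝ) ^ 2 := by
  have hl0 : 0 < l := lt_of_lt_of_le (by positivity) hl
  have hlK : t * K ≤ l := (Nat.mul_le_mul le_rfl (by omega)).trans hl
  have hg := choose_add_le_mul ht hl
  have hC : (0 : ℝ) ≤ ((K + l).choose l : ℝ) := Nat.cast_nonneg _
  have hc : ∀ i, ((t : ℝ) + 1) ^ i * ((K + l - i).choose l : ℝ) ≤ ((K + l).choose l : ℝ) :=
    fun i => by exact_mod_cast pow_mul_choose_sub_le hl0 hlK i
  rcases d with _ | d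
  · have h1 : ((K + t + l).choose (l + (t + 1)) : ℝ) * t ≤ ((K + t + l).choose (l + t) : ℝ) := by
      exact_mod_cast choose_succ_mul_le (show 0 < K + t by omega) hl rfl t
    have h2 := hc s
    simp only [Nat.sub_zero]
    calc _ = (((K + t + l).choose (l + (t + 1)) : ℝ) * t) *
          (((t : ℝ) + 1) ^ s * ((K + l - s).choose l : ℝ)) := by ring
      _ ≤ (2.719 * ((K + l).choose l : ℝ)) * ((K + l).choose l : ℝ) := by
        refine mul_le_mul (h1.trans hg) h2 (by positivity) (by positivity)
      _ = _ := by ring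
  · induction d with
    | zero =>
      have h2 := hc (s + 1)
      simp only [zero_add, Nat.add_sub_cancel]
      rw [show K + l - s - 1 = K + l - (s + 1) by omega]
      calc _ = ((K + t + l).choose (l + t) : ℝ) *
            (((t : ℝ) * (t + 1) ^ s) * ((K + l - (s + 1)).choose l : ℝ)) := by ring
        _ ≤ ((K + t + l).choose (l + t) : ℝ) *
            (((t : ℝ) + 1) ^ (s + 1) * ((K + l - (s + 1)).choose l : ℝ)) := by
          rw [pow_succ']; gcongr; linarith
        _ ≤ (2.719 * ((K + l).choose l : ℝ)) * ((K + l).choose l : ℝ) :=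
          mul_le_mul hg h2 (by positivity) (by positivity)
        _ = _ := by ring
    | succ d ih =>
      refine le_trans ?_ (ih (by omega))
      have h := choose_mul_choose_exchange (s := s) ht hl (show 1 ≤ d + 1 by omega)
        (show d + 1 ≤ t by omega)
      rw [show t + 1 - (d + 1 + 1) = t - (d + 1) by omega]
      exact mul_le_mul_of_nonneg_right (by exact_mod_cast h) (by positivity)

/-! ### Single visits after many down-steps -/

/-- The bound for a pair of families whose extreme heights `t - (s - s')` and `t + (s - s')` are
attained once, after `s` and `s'` down-steps, in units of `(n - t).choose (k - t)`. The weights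
`y * t ^ s` and `z * (t + 1) ^ s'` stand for the numbers of ways to place the down-steps. -/
lemma product_le_of_single_visit {t K l s s' u v : ℕ} (ht : 0 < t) (hl : t * (K + t) ≤ l)
    (hs : s' ≤ s) (hu : u + s = t + s') (hv : v + s' = t + s) (hu1 : 1 ≤ u) (hsl : s ≤ l)
    (hsum : s + s' ≤ K + l) (y z : ℝ) (hy : 0 ≤ y) (hz : 0 ≤ z) :
    (((K + t + l).choose (l + (u + 1)) : ℝ) +
        y * t ^ s * ((K + l - (s + s')).choose (l - s) : ℝ)) *
      (((K + t + l).choose (l + (v + 1)) : ℝ) +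
        z * (t + 1) ^ s' * ((K + l - (s + s')).choose (l - s') : ℝ)) ≤
      ((2.719 / t) ^ 2 + 2.719 / t * (y + z)) * ((K + l).choose l : ℝ) ^ 2 +
        (y * t ^ s * ((K + l - (s + s')).choose (l - s) : ℝ)) *
        (z * (t + 1) ^ s' * ((K + l - (s + s')).choose (l - s') : ℝ)) := by
  obtain ⟨d, rfl⟩ := Nat.exists_eq_add_of_le hs
  obtain rfl : u = t - d := by omega
  obtain rfl : v = t + d := by omega
  have hl0 : 0 < l := lt_of_lt_of_le (by positivity) hl
  have hlK : t * K ≤ l := (Nat.mul_le_mul le_rfl (by omega)).trans hl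
  have hg := choose_add_le_mul ht hl
  have hc : ∀ i, ((t : ℝ) + 1) ^ i * ((K + l - i).choose l : ℝ) ≤ ((K + l).choose l : ℝ) :=
    fun i => by exact_mod_cast pow_mul_choose_sub_le hl0 hlK i
  set C : ℝ := ((K + l).choose l : ℝ)
  have hC : 0 ≤ C := Nat.cast_nonneg _
  have hT0 : (0 : ℝ) < t := by exact_mod_cast ht
  have hcu : ((K + l - (s' + d + s')).choose (l - (s' + d)) : ℝ) ≤
      ((K + l - s').choose l : ℝ) := by
    have := choose_sub_le (K + l - s') l (s' + d) hsl (by omega)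
    rw [show K + l - s' - (s' + d) = K + l - (s' + d + s') by omega] at this
    exact_mod_cast this
  have hcv : ((K + l - (s' + d + s')).choose (l - s') : ℝ) ≤
      ((K + l - s' - d).choose l : ℝ) := by
    have := choose_sub_le (K + l - s' - d) l s' (by omega) (by omega)
    rw [show K + l - s' - d - s' = K + l - (s' + d + s') by omega] at this
    exact_mod_cast this
  have hguv : ((K + t + l).choose (l + (t - d + 1)) : ℝ) *
      ((K + t + l).choose (l + (t + d + 1)) : ℝ) ≤ ((K + t + l).choose (l + (t + 1)) : ℝ) ^ 2 := by
    exact_mod_cast choose_mul_choose_le_sq (l := l) (n := K + t + l)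
      (show (t - d + 1) + (t + d + 1) = 2 * (t + 1) by omega)
  have hgv' : ((K + t + l).choose (l + (t + d + 1)) : ℝ) * (t : ℝ) ^ (d + 1) ≤
      ((K + t + l).choose (l + t) : ℝ) := by
    exact_mod_cast choose_add_mul_pow_le (show 0 < K + t by omega) hl rfl t (d + 1)
  set cu : ℝ := ((K + l - (s' + d + s')).choose (l - (s' + d)) : ℝ)
  set cv : ℝ := ((K + l - (s' + d + s')).choose (l - s') : ℝ)
  set gu : ℝ := ((K + t + l).choose (l + (t - d + 1)) : ℝ) with hgu
  set gv : ℝ := ((K + t + l).choose (l + (t + d + 1)) : ℝ)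
  have hcu0 : 0 ≤ cu := Nat.cast_nonneg _
  have hcv0 : 0 ≤ cv := Nat.cast_nonneg _
  have hgu0 : 0 ≤ gu := Nat.cast_nonneg _
  have hgv0 : 0 ≤ gv := Nat.cast_nonneg _
  have b1 : gu * gv ≤ (2.719 / t) ^ 2 * C ^ 2 := by
    have h2 := choose_succ_mul_le (show 0 < K + t by omega) hl rfl t
    have h3 : ((K + t + l).choose (l + (t + 1)) : ℝ) ≤ 2.719 / t * C := by
      rw [div_mul_eq_mul_div, le_div_iff₀ hT0]
      refine le_trans ?_ hg
      exact_mod_cast h2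
    calc gu * gv ≤ ((K + t + l).choose (l + (t + 1)) : ℝ) ^ 2 := hguv
      _ ≤ (2.719 / t * C) ^ 2 := by gcongr
      _ = _ := by ring
  have b2 : gv * (y * t ^ (s' + d) * cu) ≤ 2.719 / t * y * C ^ 2 := by
    have h1 : gv * (t : ℝ) ^ (d + 1) ≤ 2.719 * C := hgv'.trans hg
    have h2 : (t : ℝ) ^ s' * cu ≤ C := by
      refine le_trans ?_ (hc s')
      gcongr
      linarith
    have h3 : (gv * (t : ℝ) ^ (d + 1)) * ((t : ℝ) ^ s' * cu) ≤ 2.719 * C * C :=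
      mul_le_mul h1 h2 (by positivity) (by positivity)
    have h4 : gv * (y * t ^ (s' + d) * cu) =
        y / t * ((gv * (t : ℝ) ^ (d + 1)) * ((t : ℝ) ^ s' * cu)) := by
      field_simp; ring
    rw [h4]
    calc _ ≤ y / t * (2.719 * C * C) := by gcongr
      _ = _ := by ring
  have b3 : gu * (z * (t + 1) ^ s' * cv) ≤ 2.719 / t * z * C ^ 2 := by
    have h1 := choose_mul_choose_sub_le ht hl s' d (by omega)
    rw [show t + 1 - d = t - d + 1 by omega, ← hgu] at h1
    have h2 : gu * cv * (t * (t + 1) ^ s') ≤ 2.719 * C ^ 2 := le_trans (by gcongr) h1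
    have h4 : gu * (z * (t + 1) ^ s' * cv) = z / t * (gu * cv * (t * (t + 1) ^ s')) := by
      field_simp
    rw [h4]
    calc _ ≤ z / t * (2.719 * C ^ 2) := by gcongr
      _ = _ := by ring
  linarith

lemma mul_le_of_single_visit {t K l s s' : ℕ} (ht : 0 < t) (hl : t * (K + t) ≤ l)
    (hsl : s ≤ l) (hs'l : s' ≤ l)
    (hsum : s + s' ≤ K + l) (y z : ℝ) (hy : 0 ≤ y) (hz : 0 ≤ z) :
    (y * t ^ s * ((K + l - (s + s')).choose (l - s) : ℝ)) *
        (z * (t + 1) ^ s' * ((K + l - (s + s')).choose (l - s') : ℝ)) ≤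
      y * z * ((K + l).choose l : ℝ) ^ 2 := by
  have hl0 : 0 < l := lt_of_lt_of_le (by positivity) hl
  have hlK : t * K ≤ l := (Nat.mul_le_mul le_rfl (by omega)).trans hl
  have hc : ∀ i, ((t : ℝ) + 1) ^ i * ((K + l - i).choose l : ℝ) ≤ ((K + l).choose l : ℝ) :=
    fun i => by exact_mod_cast pow_mul_choose_sub_le hl0 hlK i
  set C : ℝ := ((K + l).choose l : ℝ)
  have hcu : ((K + l - (s + s')).choose (l - s) : ℝ) ≤ ((K + l - s').choose l : ℝ) := by
    have := choose_sub_le (K + l - s') l s hsl (by omega)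
    rw [show K + l - s' - s = K + l - (s + s') by omega] at this
    exact_mod_cast this
  have hcv : ((K + l - (s + s')).choose (l - s') : ℝ) ≤ ((K + l - s).choose l : ℝ) := by
    have := choose_sub_le (K + l - s) l s' hs'l (by omega)
    rw [show K + l - s - s' = K + l - (s + s') by omega] at this
    exact_mod_cast this
  calc _ = y * z * (((t : ℝ) ^ s * ((K + l - (s + s')).choose (l - s') : ℝ)) *
        (((t : ℝ) + 1) ^ s' * ((K + l - (s + s')).choose (l - s) : ℝ))) := by ring
    _ ≤ y * z * ((((t : ℝ) + 1) ^ s * ((K + l - s).choose l : ℝ)) *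
        (((t : ℝ) + 1) ^ s' * ((K + l - s').choose l : ℝ))) := by
      gcongr; linarith
    _ ≤ y * z * (C * C) := by
      gcongr
      · exact hc s
      · exact hc s'
    _ = _ := by ring

lemma choose_step (m i : ℕ) :
    (m + 2).choose (i + 1) * ((i + 1) * (m + 1 - i)) = (m + 2) * (m + 1) * m.choose i := by
  have h1 := Nat.add_one_mul_choose_eq (m + 1) i
  have h2 := Nat.choose_mul_succ_eq m i
  calc _ = (m + 1 + 1).choose (i + 1) * (i + 1) * (m + 1 - i) := by ring
    _ = (m + 2) * ((m + 1).choose i * (m + 1 - i)) := by rw [← h1]; ring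
    _ = _ := by rw [← h2]; ring

lemma cast_choose_three (n : ℕ) :
    ((n + 3).choose 3 : ℝ) = (n + 3) * (n + 2) * (n + 1) / 6 := by
  have h1 := Nat.add_one_mul_choose_eq (n + 2) 2
  have h2 := Nat.cast_choose_two ℝ (n + 2)
  have h3 : ((n : ℝ) + 2 + 1) * ((n + 2).choose 2 : ℝ) = ((n + 3).choose 3 : ℝ) * 3 := by
    exact_mod_cast h1
  rw [h2] at h3
  push_cast at h3
  linarith

lemma cast_choose_four (n : ℕ) :
    ((n + 4).choose 4 : ℝ) = (n + 4) * (n + 3) * (n + 2) * (n + 1) / 24 := by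
  have h1 := Nat.add_one_mul_choose_eq (n + 3) 3
  have h3 : ((n : ℝ) + 3 + 1) * ((n + 3).choose 3 : ℝ) = ((n + 4).choose 4 : ℝ) * 4 := by
    exact_mod_cast h1
  rw [cast_choose_three] at h3
  linarith

lemma choose_div_pow_le_of_four_le {t s s' : ℕ} (ht : 14 ≤ t) (hs : 4 ≤ s) (hs' : s' ≤ s) :
    ((t + s + s').choose s : ℝ) / t ^ s ≤ 0.191 := by
  have ht0 : (0 : ℝ) < t := by positivity
  obtain ⟨w, rfl⟩ := Nat.exists_eq_add_of_le ht
  rw [div_le_iff₀ (by positivity)]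
  have h1 : ((14 + w + s + s').choose s : ℝ) ≤ ((14 + w + 2 * s).choose s : ℝ) := by
    exact_mod_cast Nat.choose_le_choose s (by omega)
  refine h1.trans ?_
  clear h1 hs'
  induction s, hs using Nat.le_induction with
  | base =>
    rw [show 14 + w + 2 * 4 = 18 + w + 4 by omega, cast_choose_four]
    push_cast
    have : (0 : ℝ) ≤ w := Nat.cast_nonneg w
    have h2 := pow_nonneg this 2
    have h3 := pow_nonneg this 3
    have h4 := pow_nonneg this 4
    nlinarith
  | succ s hs ih =>
    have h2 := choose_step (14 + w + 2 * s) s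
    have h3 : (14 + w + 2 * s + 2).choose (s + 1) ≤ (14 + w) * (14 + w + 2 * s).choose s := by
      rw [show 14 + w + 2 * s + 1 - s = 14 + w + s + 1 by omega] at h2
      refine le_of_mul_le_mul_right ?_ (show 0 < (s + 1) * (14 + w + s + 1) by positivity)
      rw [h2]
      calc (14 + w + 2 * s + 2) * (14 + w + 2 * s + 1) * (14 + w + 2 * s).choose s
          ≤ ((14 + w) * ((s + 1) * (14 + w + s + 1))) * (14 + w + 2 * s).choose s := by
            refine Nat.mul_le_mul_right _ ?_
            nlinarith [Nat.zero_le (w * s), Nat.zero_le (w * w), Nat.zero_le (w * w * s),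
              Nat.zero_le (w * (s * s))]
        _ = _ := by ring
    calc ((14 + w + 2 * (s + 1)).choose (s + 1) : ℝ)
        ≤ ((14 + w : ℕ) : ℝ) * ((14 + w + 2 * s).choose s : ℝ) := by exact_mod_cast h3
      _ ≤ ((14 + w : ℕ) : ℝ) * (0.191 * ((14 + w : ℕ) : ℝ) ^ s) := by gcongr
      _ = _ := by rw [pow_succ]; ring

lemma choose_div_pow_le {t s s' : ℕ} (ht : 14 ≤ t) (hs : s + 1 ≤ s' + t) :
    ((t + s + s').choose s' : ℝ) / (t + 1) ^ s' ≤ 2.1 := by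
  rcases s' with _ | i
  · norm_num
  rw [div_le_iff₀ (by positivity)]
  have h1 : ((t + s + (i + 1)).choose (i + 1) : ℝ) ≤ ((2 * t + 2 * i + 1).choose (i + 1) : ℝ) := by
    exact_mod_cast Nat.choose_le_choose (i + 1) (by omega)
  refine h1.trans ?_
  clear h1 hs
  have ht' : (14 : ℝ) ≤ t := by exact_mod_cast ht
  rcases i with _ | i
  · simp; linarith
  induction i with
  | zero =>
    have h := Nat.cast_choose_two ℝ (2 * t + 2 * (0 + 1) + 1)
    rw [show 0 + 1 + 1 = 2 by omega, h]
    push_cast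
    nlinarith
  | succ i ih =>
    have h2 := choose_step (2 * t + 2 * (i + 1) + 1) (i + 1 + 1)
    have h3 : (2 * t + 2 * (i + 1) + 1 + 2).choose (i + 1 + 1 + 1) ≤
        (t + 1) * (2 * t + 2 * (i + 1) + 1).choose (i + 1 + 1) := by
      rw [show 2 * t + 2 * (i + 1) + 1 + 1 - (i + 1 + 1) = 2 * t + i + 2 by omega] at h2
      refine le_of_mul_le_mul_right ?_ (show 0 < (i + 1 + 1 + 1) * (2 * t + i + 2) by positivity)
      rw [h2]
      calc _ ≤ ((t + 1) * ((i + 1 + 1 + 1) * (2 * t + i + 2))) *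
            (2 * t + 2 * (i + 1) + 1).choose (i + 1 + 1) := by
            refine Nat.mul_le_mul_right _ ?_
            obtain ⟨w, rfl⟩ := Nat.exists_eq_add_of_le ht
            nlinarith [Nat.zero_le (w * i), Nat.zero_le (w * w), Nat.zero_le (w * w * i),
              Nat.zero_le (w * (i * i))]
        _ = _ := by ring
    calc ((2 * t + 2 * (i + 1 + 1) + 1).choose (i + 1 + 1 + 1) : ℝ)
        ≤ ((t + 1 : ℕ) : ℝ) * ((2 * t + 2 * (i + 1) + 1).choose (i + 1 + 1) : ℝ) := by
          exact_mod_cast h3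
      _ ≤ ((t + 1 : ℕ) : ℝ) * (2.1 * ((t : ℝ) + 1) ^ (i + 1 + 1)) := by gcongr
      _ = _ := by push_cast; ring

lemma add_mul_add_le {t s s' : ℕ} (ht : 14 ≤ t) (hs2 : 2 ≤ s) (hs : s' ≤ s) (hst : s + 1 ≤ s' + t)
    (hne : s = 2 → s' ≠ 1) :
    (2.719 / t + ((t + s + s').choose s : ℝ) / t ^ s) *
      (2.719 / t + ((t + s + s').choose s' : ℝ) / (t + 1) ^ s') ≤ 0.985 := by
  have ht' : (14 : ℝ) ≤ t := by exact_mod_cast ht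
  have hx : 2.719 / (t : ℝ) ≤ 0.1943 := by
    rw [div_le_iff₀ (by positivity)]; linarith
  have hx0 : 0 ≤ 2.719 / (t : ℝ) := by positivity
  have key : ∀ Y Z : ℝ, ((t + s + s').choose s : ℝ) / t ^ s ≤ Y →
      ((t + s + s').choose s' : ℝ) / (t + 1) ^ s' ≤ Z → (0.1943 + Y) * (0.1943 + Z) ≤ 0.985 →
      (2.719 / t + ((t + s + s').choose s : ℝ) / t ^ s) *
        (2.719 / t + ((t + s + s').choose s' : ℝ) / (t + 1) ^ s') ≤ 0.985 := by
    intro Y Z hY hZ h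
    refine le_trans ?_ h
    gcongr
    have : 0 ≤ ((t + s + s').choose s : ℝ) / t ^ s := by positivity
    linarith
  rcases le_or_gt 4 s with h4 | h4
  · exact key 0.191 2.1 (choose_div_pow_le_of_four_le ht h4 hs) (choose_div_pow_le ht hst)
      (by norm_num)
  interval_cases s
  · have h : s' = 0 ∨ s' = 2 := by omega
    rcases h with rfl | rfl
    · refine key 0.6125 1 ?_ (by simp) (by norm_num)
      rw [div_le_iff₀ (by positivity), Nat.cast_choose_two]
      push_cast
      nlinarith
    · refine key 0.7807 0.6801 ?_ ?_ (by norm_num) <;>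
      · rw [div_le_iff₀ (by positivity), Nat.cast_choose_two]
        push_cast
        nlinarith
  · refine key 0.4157 1.2 ?_ ?_ (by norm_num)
    · rw [div_le_iff₀ (by positivity)]
      have h1 : ((t + 3 + s').choose 3 : ℝ) ≤ ((t + 3 + 3).choose 3 : ℝ) := by
        exact_mod_cast Nat.choose_le_choose 3 (by omega)
      refine h1.trans ?_
      rw [cast_choose_three]
      push_cast
      nlinarith [mul_nonneg (sub_nonneg.2 ht') (sub_nonneg.2 ht'),
        mul_nonneg (mul_nonneg (sub_nonneg.2 ht') (sub_nonneg.2 ht')) (sub_nonneg.2 ht')]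
    · rw [div_le_iff₀ (by positivity)]
      interval_cases s'
      · norm_num
      · simp; linarith
      · rw [Nat.cast_choose_two]; push_cast; nlinarith
      · rw [cast_choose_three]; push_cast
        nlinarith [mul_nonneg (sub_nonneg.2 ht') (sub_nonneg.2 ht'),
          mul_nonneg (mul_nonneg (sub_nonneg.2 ht') (sub_nonneg.2 ht')) (sub_nonneg.2 ht')]

/-- If `x` and `y` are `C` times the probabilities of drawing two, respectively one, of `l` balls
in three draws without replacement from `K + l` balls, in a fixed order, then `x * y` is at most
`(t / (t + 1) ^ 2) ^ 3 * C ^ 2`, up to the factor `1.021` for sampling without replacement. -/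
lemma mul_mul_pow_le_of_falling {t K l x y C : ℝ} (htr : 14 ≤ t) (hKr : 2 ≤ K) (hlr : 196 ≤ l)
    (htK : t * K ≤ l)
    (hx : x * ((K + l) * (K + l - 1) * (K + l - 2)) = C * (l * (l - 1) * K))
    (hy' : y * ((K + l) * (K + l - 1) * (K + l - 2)) = C * (l * (K - 1) * K)) :
    x * y * (t + 1) ^ 6 ≤ 1.021 * t ^ 3 * C ^ 2 := by
  have hM : 0 < (K + l) * (K + l - 1) * (K + l - 2) := by
    have h1 : (0 : ℝ) < K + l - 1 := by linarith
    have h2 : (0 : ℝ) < K + l - 2 := by linarith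
    positivity
  have hprod : x * y * ((K + l) * (K + l - 1) * (K + l - 2)) ^ 2 =
      C ^ 2 * ((l - 1) * (K - 1) * (l * K) ^ 2) := by
    linear_combination y * ((K + l) * (K + l - 1) * (K + l - 2)) * hx +
      C * (l * (l - 1) * K) * hy'
  have hKl : l * K * (t + 1) ^ 2 ≤ t * (K + l) ^ 2 := by
    have h1 : 0 ≤ (l - t * K) * (t * l - K) := by
      refine mul_nonneg (by linarith) ?_
      nlinarith
    nlinarith
  have hcube : (l * K) ^ 3 * (t + 1) ^ 6 ≤ t ^ 3 * (K + l) ^ 6 := by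
    calc (l * K) ^ 3 * (t + 1) ^ 6 = (l * K * (t + 1) ^ 2) ^ 3 := by ring
      _ ≤ (t * (K + l) ^ 2) ^ 3 := by gcongr
      _ = _ := by ring
  have hfall : (l - 1) * (K - 1) * (K + l) ^ 2 ≤ l * K * (K + l - 1) ^ 2 := by
    have h1 : (l - 1) * (K + l) ≤ l * (K + l - 1) := by nlinarith
    have h2 : (K - 1) * (K + l) ≤ K * (K + l - 1) := by nlinarith
    calc (l - 1) * (K - 1) * (K + l) ^ 2
        = ((l - 1) * (K + l)) * ((K - 1) * (K + l)) := by ring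
      _ ≤ (l * (K + l - 1)) * (K * (K + l - 1)) := by
        refine mul_le_mul h1 h2 (mul_nonneg (by linarith) (by linarith)) (by nlinarith)
      _ = _ := by ring
  have hround : (K + l) ^ 2 ≤ 1.021 * (K + l - 2) ^ 2 := by
    have h1 : K + l ≤ 1.0103 * (K + l - 2) := by linarith
    calc (K + l) ^ 2 ≤ (1.0103 * (K + l - 2)) ^ 2 := by gcongr
      _ = 1.0103 ^ 2 * (K + l - 2) ^ 2 := by ring
      _ ≤ _ := by gcongr; norm_num
  refine le_of_mul_le_mul_right ?_
    (show (0 : ℝ) < ((K + l) * (K + l - 1) * (K + l - 2)) ^ 2 * (K + l) ^ 2 by positivity)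
  calc x * y * (t + 1) ^ 6 * (((K + l) * (K + l - 1) * (K + l - 2)) ^ 2 * (K + l) ^ 2)
      = (x * y * ((K + l) * (K + l - 1) * (K + l - 2)) ^ 2) * (t + 1) ^ 6 * (K + l) ^ 2 := by
        ring
    _ = C ^ 2 * ((l * K) ^ 2 * (t + 1) ^ 6) * (((l - 1) * (K - 1)) * (K + l) ^ 2) := by
        rw [hprod]; ring
    _ ≤ C ^ 2 * ((l * K) ^ 2 * (t + 1) ^ 6) * (l * K * (K + l - 1) ^ 2) := by gcongr
    _ = C ^ 2 * (K + l - 1) ^ 2 * ((l * K) ^ 3 * (t + 1) ^ 6) := by ring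
    _ ≤ C ^ 2 * (K + l - 1) ^ 2 * (t ^ 3 * (K + l) ^ 6) := by gcongr
    _ = C ^ 2 * (K + l - 1) ^ 2 * t ^ 3 * (K + l) ^ 4 * (K + l) ^ 2 := by ring
    _ ≤ C ^ 2 * (K + l - 1) ^ 2 * t ^ 3 * (K + l) ^ 4 * (1.021 * (K + l - 2) ^ 2) := by gcongr
    _ = _ := by ring

/-- For `s = 2` and `s' = 1` the general estimate falls short. The sharper one used here keeps the
probabilities of the down-steps, through `K * l / (K + l) ^ 2 ≤ t / (t + 1) ^ 2`. -/
lemma mul_le_of_two_one {t K l : ℕ} (ht : 14 ≤ t) (hl : t * (K + t) ≤ l) :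
    (((t + 3).choose 2 : ℝ) * ((K + l - 3).choose (l - 2) : ℝ)) *
        ((t + 3) * ((K + l - 3).choose (l - 1) : ℝ)) ≤ 0.57 * ((K + l).choose l : ℝ) ^ 2 := by
  have hl196 : 196 ≤ l := le_trans (by nlinarith) hl
  rcases Nat.lt_or_ge K 2 with hK | hK
  · rw [Nat.choose_eq_zero_of_lt (n := K + l - 3) (k := l - 1) (by omega)]
    simp only [Nat.cast_zero, mul_zero]
    positivity
  have hc1 : ((K + l - 3).choose (l - 2) : ℝ) * ((K + l : ℝ) * (K + l - 1) * (K + l - 2)) =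
      ((K + l).choose l : ℝ) * (l * (l - 1) * K) := by
    obtain ⟨a, rfl⟩ := Nat.exists_eq_add_of_le' hK
    obtain ⟨b, rfl⟩ := Nat.exists_eq_add_of_le' (show 2 ≤ l by omega)
    have h1 := Nat.add_one_mul_choose_eq (a + b + 1) b
    have h2 := Nat.add_one_mul_choose_eq (a + b + 2) (b + 1)
    have h3 := Nat.choose_mul_succ_eq (a + b + 3) (b + 2)
    rw [show a + b + 3 + 1 - (b + 2) = a + 2 by omega] at h3
    rw [show a + 2 + (b + 2) - 3 = a + b + 1 by omega, Nat.add_sub_cancel,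
      show a + 2 + (b + 2) = a + b + 3 + 1 by omega]
    have e1 : ((a : ℝ) + b + 1 + 1) * ((a + b + 1).choose b : ℝ) =
      ((a + b + 2).choose (b + 1) : ℝ) * (b + 1) := by exact_mod_cast h1
    have e2 : ((a : ℝ) + b + 2 + 1) * ((a + b + 2).choose (b + 1) : ℝ) =
      ((a + b + 3).choose (b + 2) : ℝ) * (b + 1 + 1) := by exact_mod_cast h2
    have e3 : ((a + b + 3).choose (b + 2) : ℝ) * (a + b + 3 + 1) =
      ((a + b + 3 + 1).choose (b + 2) : ℝ) * (a + 2) := by exact_mod_cast h3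
    push_cast
    linear_combination ((a : ℝ) + b + 3 + 1) * (a + b + 2 + 1) * e1 +
      ((a : ℝ) + b + 3 + 1) * (b + 1) * e2 + ((b : ℝ) + 2) * (b + 1) * e3
  have hc2 : ((K + l - 3).choose (l - 1) : ℝ) * ((K + l : ℝ) * (K + l - 1) * (K + l - 2)) =
      ((K + l).choose l : ℝ) * (l * (K - 1) * K) := by
    obtain ⟨a, rfl⟩ := Nat.exists_eq_add_of_le' hK
    obtain ⟨b, rfl⟩ := Nat.exists_eq_add_of_le' (show 2 ≤ l by omega)
    have h1 := Nat.add_one_mul_choose_eq (a + b + 1) (b + 1)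
    have h2 := Nat.choose_mul_succ_eq (a + b + 2) (b + 2)
    have h3 := Nat.choose_mul_succ_eq (a + b + 3) (b + 2)
    rw [show a + b + 3 + 1 - (b + 2) = a + 2 by omega] at h3
    rw [show a + b + 2 + 1 - (b + 2) = a + 1 by omega] at h2
    rw [show a + 2 + (b + 2) - 3 = a + b + 1 by omega, show b + 2 - 1 = b + 1 by omega,
      show a + 2 + (b + 2) = a + b + 3 + 1 by omega]
    have e1 : ((a : ℝ) + b + 1 + 1) * ((a + b + 1).choose (b + 1) : ℝ) =
      ((a + b + 2).choose (b + 2) : ℝ) * (b + 1 + 1) := by exact_mod_cast h1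
    have e2 : ((a + b + 2).choose (b + 2) : ℝ) * (a + b + 2 + 1) =
      ((a + b + 3).choose (b + 2) : ℝ) * (a + 1) := by exact_mod_cast h2
    have e3 : ((a + b + 3).choose (b + 2) : ℝ) * (a + b + 3 + 1) =
      ((a + b + 3 + 1).choose (b + 2) : ℝ) * (a + 2) := by exact_mod_cast h3
    push_cast
    linear_combination ((a : ℝ) + b + 3 + 1) * (a + b + 2 + 1) * e1 +
      ((a : ℝ) + b + 3 + 1) * (b + 2) * e2 + ((b : ℝ) + 2) * (a + 1) * e3
  have hT := Nat.cast_choose_two ℝ (t + 3)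
  push_cast at hT
  rw [hT]
  set cu : ℝ := ((K + l - 3).choose (l - 2) : ℝ)
  set cv : ℝ := ((K + l - 3).choose (l - 1) : ℝ)
  set C : ℝ := ((K + l).choose l : ℝ)
  have hKr : (2 : ℝ) ≤ K := by exact_mod_cast hK
  have hlr : (196 : ℝ) ≤ l := by exact_mod_cast hl196
  have htr : (14 : ℝ) ≤ t := by exact_mod_cast ht
  have htK : (t : ℝ) * K ≤ l := by
    have : t * K ≤ l := (Nat.mul_le_mul le_rfl (by omega)).trans hl
    exact_mod_cast this
  have hmain := mul_mul_pow_le_of_falling htr hKr hlr htK hc1 hc2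
  have hpoly : ((t : ℝ) + 3) ^ 2 * (t + 2) * t ^ 3 ≤ 1.115 * (t + 1) ^ 6 := by
    obtain ⟨w, hw, hw0⟩ : ∃ w : ℝ, (t : ℝ) = 14 + w ∧ 0 ≤ w := ⟨t - 14, by ring, by linarith⟩
    rw [hw, ← sub_nonneg]
    ring_nf
    positivity
  refine le_of_mul_le_mul_right ?_ (show (0 : ℝ) < 2 * (t + 1) ^ 6 by positivity)
  calc (((t : ℝ) + 3) * (t + 3 - 1) / 2 * cu) * ((t + 3) * cv) * (2 * (t + 1) ^ 6)
      = ((t : ℝ) + 3) ^ 2 * (t + 2) * (cu * cv * (t + 1) ^ 6) := by ring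
    _ ≤ ((t : ℝ) + 3) ^ 2 * (t + 2) * (1.021 * t ^ 3 * C ^ 2) := by gcongr
    _ = (((t : ℝ) + 3) ^ 2 * (t + 2) * t ^ 3) * (1.021 * C ^ 2) := by ring
    _ ≤ (1.115 * (t + 1) ^ 6) * (1.021 * C ^ 2) := by gcongr
    _ ≤ _ := by
      have : 0 ≤ C ^ 2 * ((t : ℝ) + 1) ^ 6 := by positivity
      nlinarith

/-- The product of the sizes when a single visit happens after at least two down-steps. -/
lemma card_mul_card_le_of_two_le {t K l s s' u v : ℕ} (ht : 14 ≤ t) (hl : t * (K + t) ≤ l)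
    (hs2 : 2 ≤ s) (hs : s' ≤ s) (hu : u + s = t + s') (hv : v + s' = t + s) (hu1 : 1 ≤ u)
    (hsl : s ≤ l) (hsum : s + s' ≤ K + l) {a b : ℝ} (hb0 : 0 ≤ b)
    (ha : a ≤ ((K + t + l).choose (l + (u + 1)) : ℝ) +
      ((t + s + s').choose s : ℝ) * ((K + l - (s + s')).choose (l - s) : ℝ))
    (hb : b ≤ ((K + t + l).choose (l + (v + 1)) : ℝ) +
      ((t + s + s').choose s' : ℝ) * ((K + l - (s + s')).choose (l - s') : ℝ)) :
    a * b ≤ 0.985 * ((K + l).choose l : ℝ) ^ 2 := by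
  have ht' : (14 : ℝ) ≤ t := by exact_mod_cast ht
  have h1 := product_le_of_single_visit (by omega) hl hs hu hv hu1 hsl hsum
    (((t + s + s').choose s : ℝ) / t ^ s) (((t + s + s').choose s' : ℝ) / (t + 1) ^ s')
    (by positivity) (by positivity)
  have h2 := mul_le_of_single_visit (by omega) hl hsl (by omega) hsum
    (((t + s + s').choose s : ℝ) / t ^ s) (((t + s + s').choose s' : ℝ) / (t + 1) ^ s')
    (by positivity) (by positivity)
  rw [div_mul_cancel₀ _ (by positivity), div_mul_cancel₀ _ (by positivity)] at h1 h2
  refine (mul_le_mul ha hb hb0 (by positivity)).trans (h1.trans ?_)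
  by_cases h21 : s = 2 ∧ s' = 1
  · obtain ⟨rfl, rfl⟩ := h21
    have h3 := mul_le_of_two_one ht hl
    have hC : 0 ≤ ((K + l).choose l : ℝ) ^ 2 := by positivity
    have hx : 2.719 / (t : ℝ) ≤ 0.1943 := by
      rw [div_le_iff₀ (by positivity)]; linarith
    have hx0 : 0 ≤ 2.719 / (t : ℝ) := by positivity
    have hy : ((t + 2 + 1).choose 2 : ℝ) / t ^ 2 ≤ 0.695 := by
      rw [div_le_iff₀ (by positivity), Nat.cast_choose_two]
      push_cast
      nlinarith
    have hz : ((t + 2 + 1).choose 1 : ℝ) / (t + 1) ^ 1 ≤ 1.134 := by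
      rw [div_le_iff₀ (by positivity)]
      simp; linarith
    have hc : (2.719 / (t : ℝ)) ^ 2 + 2.719 / t * (((t + 2 + 1).choose 2 : ℝ) / t ^ 2 +
        ((t + 2 + 1).choose 1 : ℝ) / (t + 1) ^ 1) ≤ 0.415 := by
      calc _ ≤ (0.1943 : ℝ) ^ 2 + 0.1943 * (0.695 + 1.134) := by gcongr
        _ ≤ _ := by norm_num
    have h4 : (((t + 2 + 1).choose 2 : ℝ) * ((K + l - (2 + 1)).choose (l - 2) : ℝ)) *
        (((t + 2 + 1).choose 1 : ℝ) * ((K + l - (2 + 1)).choose (l - 1) : ℝ)) ≤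
        0.57 * ((K + l).choose l : ℝ) ^ 2 := by
      rw [Nat.choose_one_right]
      push_cast
      rw [show (t : ℝ) + 2 + 1 = t + 3 by ring]
      exact h3
    calc _ ≤ 0.415 * ((K + l).choose l : ℝ) ^ 2 + 0.57 * ((K + l).choose l : ℝ) ^ 2 :=
          add_le_add (by gcongr) h4
      _ = _ := by ring
  · have h3 := add_mul_add_le ht hs2 hs (by omega) (fun h h' => h21 ⟨h, h'⟩)
    refine (add_le_add le_rfl h2).trans ?_
    refine le_trans (le_of_eq ?_) (mul_le_mul_of_nonneg_right h3 (by positivity))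
    ring

/-! ### Gains against losses -/

lemma twelve_pow_mul_choose_le (w b m : ℕ) (hw : 12 * w ≤ b + 1) :
    12 ^ m * (w + b + m).choose (b + m) ≤ 13 ^ m * (w + b).choose b := by
  induction m with
  | zero => simp
  | succ m ih =>
    have h := Nat.add_one_mul_choose_eq (w + b + m) (b + m)
    have h1 : 12 * (w + b + m + 1).choose (b + m + 1) ≤ 13 * (w + b + m).choose (b + m) := by
      refine le_of_mul_le_mul_right ?_ (show 0 < b + m + 1 by omega)
      calc 12 * (w + b + m + 1).choose (b + m + 1) * (b + m + 1)
          = (12 * (w + b + m + 1)) * (w + b + m).choose (b + m) := by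
            rw [mul_assoc, ← h]; ring
        _ ≤ (13 * (b + m + 1)) * (w + b + m).choose (b + m) := Nat.mul_le_mul_right _ (by omega)
        _ = _ := by ring
    calc 12 ^ (m + 1) * (w + b + (m + 1)).choose (b + (m + 1))
        = 12 ^ m * (12 * (w + b + m + 1).choose (b + m + 1)) := by rw [pow_succ]; ring_nf
      _ ≤ 12 ^ m * (13 * (w + b + m).choose (b + m)) := Nat.mul_le_mul_left _ h1
      _ = 13 * (12 ^ m * (w + b + m).choose (b + m)) := by ring
      _ ≤ 13 * (13 ^ m * (w + b).choose b) := Nat.mul_le_mul_left _ ih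
      _ = _ := by ring

lemma choose_add_two_mul_le (w b : ℕ) (hw : 12 * w ≤ b) :
    144 * (w + b).choose (b + 2) ≤ (w + b).choose b := by
  have h1 := Nat.choose_succ_right_eq (w + b) b
  have h2 := Nat.choose_succ_right_eq (w + b) (b + 1)
  have h3 : 12 * (w + b).choose (b + 1) ≤ (w + b).choose b := by
    refine le_of_mul_le_mul_right ?_ (show 0 < b + 1 by omega)
    calc _ = 12 * ((w + b).choose (b + 1) * (b + 1)) := by ring
      _ = (w + b).choose b * (12 * (w + b - b)) := by rw [h1]; ring
      _ ≤ _ := Nat.mul_le_mul_left _ (by omega)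
  have h4 : 12 * (w + b).choose (b + 2) ≤ (w + b).choose (b + 1) := by
    refine le_of_mul_le_mul_right ?_ (show 0 < b + 2 by omega)
    calc _ = 12 * ((w + b).choose (b + 1 + 1) * (b + 1 + 1)) := by ring
      _ = (w + b).choose (b + 1) * (12 * (w + b - (b + 1))) := by rw [h2]; ring
      _ ≤ _ := Nat.mul_le_mul_left _ (by omega)
  omega

section Units

variable {t K l : ℕ}

/-- The smallest possible gain, against the size of the extremal family. -/
lemma choose_le_mul_choose (ht : 14 ≤ t) (hl : t * (K + t) ≤ l) {s s' u : ℕ} (hs : s ≤ 1)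
    (hs' : s' ≤ 1) (hu : u + s = t + s') (hs'K : s' ≤ K) :
    ((K + t + l).choose (l + (u + 1)) : ℝ) ≤
      0.21 * (((t + s + s').choose s : ℝ) * ((K + l - (s + s')).choose (l - s) : ℝ)) := by
  have ht' : (14 : ℝ) ≤ t := by exact_mod_cast ht
  have hl0 : 0 < l := lt_of_lt_of_le (by positivity) hl
  have hlr : (0 : ℝ) < l := by exact_mod_cast hl0
  have hlK : (14 : ℝ) * K ≤ l := by
    have : 14 * K ≤ l := (Nat.mul_le_mul ht (by omega)).trans hl
    exact_mod_cast this
  have hg := choose_add_le_mul (show 0 < t by omega) hl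
  -- The height `t + 1`, exactly and up to the factor `t`.
  have g1 : ((K + t + l).choose (l + (t + 1)) : ℝ) * (l + t + 1) =
      ((K + t + l).choose (l + t) : ℝ) * K := by
    have h := Nat.choose_succ_right_eq (K + t + l) (l + t)
    rw [show K + t + l - (l + t) = K by omega] at h
    exact_mod_cast h
  have g2 : ∀ j, ((K + t + l).choose (l + (j + 1)) : ℝ) * t ≤
      ((K + t + l).choose (l + j) : ℝ) := fun j => by
    exact_mod_cast choose_succ_mul_le (show 0 < K + t by omega) hl rfl j
  have hK0 : (0 : ℝ) ≤ K := Nat.cast_nonneg K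
  interval_cases s <;> interval_cases s'
  · obtain rfl : u = t := by omega
    have h1 := g2 u
    simp
    nlinarith
  · obtain rfl : u = t + 1 := by omega
    obtain ⟨a, rfl⟩ := Nat.exists_eq_add_of_le' hs'K
    have h1 := g2 (t + 1)
    have h2 := Nat.choose_mul_succ_eq (a + l) l
    rw [show a + l + 1 - l = a + 1 by omega] at h2
    rw [show a + 1 + l - (0 + 1) = a + l by omega, Nat.choose_zero_right, Nat.sub_zero]
    rw [show a + 1 + l = a + l + 1 by omega] at hg
    have e2 : ((a + l).choose l : ℝ) * (a + l + 1) = ((a + l + 1).choose l : ℝ) * (a + 1) := by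
      exact_mod_cast h2
    set c : ℝ := ((a + l).choose l : ℝ)
    have hc : 0 ≤ c := Nat.cast_nonneg _
    push_cast at *
    set G1 : ℝ := ((a + 1 + t + l).choose (l + (t + 1)) : ℝ)
    set G2 : ℝ := ((a + 1 + t + l).choose (l + (t + 1 + 1)) : ℝ)
    have h4 : G1 * (l + t + 1) ≤ 2.719 * (c * (a + l + 1)) := by
      rw [g1, e2]; nlinarith
    have h5 : G1 * l ≤ 2.719 * (15 / 14) * c * l := by
      have : 0 ≤ G1 := Nat.cast_nonneg _
      nlinarith
    have h6 : G1 ≤ 2.719 * (15 / 14) * c := le_of_mul_le_mul_right h5 hlr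
    have : 0 ≤ G2 := Nat.cast_nonneg _
    nlinarith
  · obtain ⟨b, rfl⟩ := Nat.exists_eq_add_of_le' hl0
    obtain rfl : t = u + 1 := by omega
    have h2 := Nat.add_one_mul_choose_eq (K + b) b
    rw [show K + (b + 1) - (1 + 0) = K + b by omega, Nat.add_sub_cancel, Nat.choose_one_right]
    rw [show K + (b + 1) = K + b + 1 by omega] at hg
    have e2 : ((K : ℝ) + b + 1) * ((K + b).choose b : ℝ) =
      ((K + b + 1).choose (b + 1) : ℝ) * (b + 1) := by exact_mod_cast h2
    set c : ℝ := ((K + b).choose b : ℝ)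
    have hc : 0 ≤ c := Nat.cast_nonneg _
    push_cast at *
    have h5 : ((K + b + 1).choose (b + 1) : ℝ) * (b + 1) ≤ 15 / 14 * c * (b + 1) := by
      rw [← e2]; nlinarith
    have h6 := le_of_mul_le_mul_right h5 hlr
    nlinarith
  · obtain ⟨b, rfl⟩ := Nat.exists_eq_add_of_le' hl0
    obtain ⟨a, rfl⟩ := Nat.exists_eq_add_of_le' hs'K
    obtain rfl : u = t := by omega
    have h1 := Nat.add_one_mul_choose_eq (a + b) b
    have h2 := Nat.choose_mul_succ_eq (a + b + 1) (b + 1)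
    rw [show a + b + 1 + 1 - (b + 1) = a + 1 by omega] at h2
    rw [show a + 1 + (b + 1) - (1 + 1) = a + b by omega, Nat.add_sub_cancel, Nat.choose_one_right]
    rw [show a + 1 + (b + 1) = a + b + 1 + 1 by omega] at hg
    have e1 : ((a : ℝ) + b + 1) * ((a + b).choose b : ℝ) =
      ((a + b + 1).choose (b + 1) : ℝ) * (b + 1) := by exact_mod_cast h1
    have e2 : ((a + b + 1).choose (b + 1) : ℝ) * (a + b + 1 + 1) =
      ((a + b + 1 + 1).choose (b + 1) : ℝ) * (a + 1) := by exact_mod_cast h2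
    set c : ℝ := ((a + b).choose b : ℝ)
    have hc : 0 ≤ c := Nat.cast_nonneg _
    set D : ℝ := ((a + b + 1).choose (b + 1) : ℝ)
    have hD0 : 0 ≤ D := Nat.cast_nonneg _
    push_cast at *
    set G1 : ℝ := ((a + 1 + u + (b + 1)).choose (b + 1 + (u + 1)) : ℝ)
    have hG0 : 0 ≤ G1 := Nat.cast_nonneg _
    have h3 : D ≤ 15 / 14 * c := by
      refine le_of_mul_le_mul_right ?_ hlr
      rw [← e1]; nlinarith
    have h4 : G1 ≤ 2.719 * (15 / 14) * D := by
      refine le_of_mul_le_mul_right ?_ hlr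
      have : G1 * (b + 1 + u + 1) ≤ 2.719 * (D * (a + b + 1 + 1)) := by
        rw [g1, e2]; nlinarith
      nlinarith
    nlinarith

/-- The extremal family is little larger than its part whose members miss exactly `s'` elements of
`[T]`, all of them in `[t]`. -/
lemma card_prefixFamily_le (ht : 14 ≤ t) (hl : t * (K + t) ≤ l) {s s' : ℕ} (hs : s ≤ 1)
    (hs' : s' ≤ 1) (hT : t + s + s' ≤ K + t + l) :
    (#(prefixFamily (K + t + l) (K + t) (t + s + s') s') : ℝ) ≤
      7 / 6 * ((t.choose s' : ℝ) * ((K + l - (s + s')).choose (l - s') : ℝ)) := by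
  have hl0 : 0 < l := lt_of_lt_of_le (by positivity) hl
  have hsub : K + t + l - (t + s + s') = K + l - (s + s') := by omega
  have ht' : (14 : ℝ) ≤ t := by exact_mod_cast ht
  interval_cases s'
  · rw [card_prefixFamily_zero rfl hT, hsub]
    simp only [Nat.choose_zero_right, Nat.sub_zero]
    have : (0 : ℝ) ≤ ((K + l - (s + 0)).choose l : ℝ) := Nat.cast_nonneg _
    push_cast
    linarith
  · rw [card_prefixFamily_one rfl hT (by omega) hl0, hsub, Nat.choose_one_right]
    obtain ⟨b, rfl⟩ := Nat.exists_eq_add_of_le' hl0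
    have h1 := Nat.choose_succ_right_eq (K + (b + 1) - (s + 1)) b
    rw [Nat.add_sub_cancel]
    have h2 : 14 * (K + (b + 1) - (s + 1)).choose (b + 1) ≤ (K + (b + 1) - (s + 1)).choose b := by
      refine le_of_mul_le_mul_right ?_ hl0
      have h3 : 14 * K ≤ b + 1 := (Nat.mul_le_mul ht (by omega)).trans hl
      calc _ = 14 * ((K + (b + 1) - (s + 1)).choose (b + 1) * (b + 1)) := by ring
        _ = (K + (b + 1) - (s + 1)).choose b * (14 * (K + (b + 1) - (s + 1) - b)) := by
          rw [h1]; ring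
        _ ≤ _ := Nat.mul_le_mul_left _ (by omega)
    have h4 : (14 : ℝ) * ((K + (b + 1) - (s + 1)).choose (b + 1) : ℝ) ≤
      ((K + (b + 1) - (s + 1)).choose b : ℝ) := by exact_mod_cast h2
    have hs1 : (s : ℝ) ≤ 1 := by exact_mod_cast hs
    push_cast
    set c : ℝ := ((K + (b + 1) - (s + 1)).choose b : ℝ)
    have hc : 0 ≤ c := Nat.cast_nonneg _
    nlinarith

/-- The sets lost through `r + 3` forced down-steps, against the size of the extremal family. The
factor `t ^ r` is what a gain at a height larger by `r` costs. -/
lemma choose_sub_choose_ge (ht : 14 ≤ t) (hl : t * (K + t) ≤ l) {s s' r : ℕ} (hsK : s ≤ K)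
    (hs' : s' ≤ 1) (hr : r + 2 ≤ K + t) :
    0.77 * ((K + l - (s + s')).choose (l - s') : ℝ) ≤
      (t : ℝ) ^ r * ((K + l - (s + s') - (r + 3)).choose (l - s' - (r + 3)) -
        (K + l - (s + s') - (r + 3)).choose (l - s' - (r + 3) + 2) : ℕ) := by
  have ht' : (14 : ℝ) ≤ t := by exact_mod_cast ht
  have hlk : 14 * (K + t) ≤ l := (Nat.mul_le_mul ht le_rfl).trans hl
  obtain ⟨w, rfl⟩ := Nat.exists_eq_add_of_le hsK
  obtain ⟨b, hb⟩ : ∃ b, l = b + (s' + (r + 3)) := ⟨l - (s' + (r + 3)), by omega⟩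
  rw [show s + w + l - (s + s') - (r + 3) = w + b by omega,
    show l - s' - (r + 3) = b by omega, show s + w + l - (s + s') = w + b + (r + 3) by omega,
    show l - s' = b + (r + 3) by omega]
  have h1 := twelve_pow_mul_choose_le w b (r + 3) (by omega)
  have h2 := choose_add_two_mul_le w b (by omega)
  have h3 : (143 : ℝ) / 144 * ((w + b).choose b : ℝ) ≤
      ((w + b).choose b - (w + b).choose (b + 2) : ℕ) := by
    rw [Nat.cast_sub (by omega)]
    have : (144 : ℝ) * ((w + b).choose (b + 2) : ℝ) ≤ ((w + b).choose b : ℝ) := by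
      exact_mod_cast h2
    linarith
  have h4 : (12 : ℝ) ^ (r + 3) * ((w + b + (r + 3)).choose (b + (r + 3)) : ℝ) ≤
      13 ^ (r + 3) * ((w + b).choose b : ℝ) := by exact_mod_cast h1
  have h5 : (13 : ℝ) ^ r ≤ t ^ r * 12 ^ r := by
    rw [← mul_pow]
    gcongr
    linarith
  set c : ℝ := ((w + b + (r + 3)).choose (b + (r + 3)) : ℝ)
  set c' : ℝ := ((w + b).choose b : ℝ)
  have hc' : 0 ≤ c' := Nat.cast_nonneg _
  refine le_trans ?_ (mul_le_mul_of_nonneg_left h3 (by positivity))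
  refine le_of_mul_le_mul_left ?_ (show (0 : ℝ) < 12 ^ (r + 3) by positivity)
  calc (12 : ℝ) ^ (r + 3) * (0.77 * c) = 0.77 * (12 ^ (r + 3) * c) := by ring
    _ ≤ 0.77 * (13 ^ (r + 3) * c') := by gcongr
    _ = 0.77 * 13 ^ 3 * (13 ^ r * c') := by rw [pow_add]; ring
    _ ≤ 0.77 * 13 ^ 3 * ((t ^ r * 12 ^ r) * c') := by gcongr
    _ ≤ 12 ^ 3 * (143 / 144) * ((t ^ r * 12 ^ r) * c') := by
      gcongr ?_ * _
      norm_num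
    _ = _ := by rw [pow_add]; ring

/-- What `A` gains outside its extremal family costs `B` at least twice as large a share of the
corresponding extremal family. -/
lemma two_mul_gain_le_loss (ht : 14 ≤ t) (hl : t * (K + t) ≤ l) {s s' u : ℕ} (hs : s ≤ 1)
    (hs' : s' ≤ 1) (hu : u + s = t + s') (hsK : s ≤ K) (hs'K : s' ≤ K)
    {A B : Finset (Finset ℕ)} (hA : IsUniformFamily (K + t + l) (K + t) A)
    (hAs : IsShifted (K + t + l) A) (hAB : CrossIntersecting t A B)
    (hAr : ∀ F ∈ A, Reaches (K + t + l) (u + 1) F ∨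
      t + s + s' ≤ prefixCard F (t + s + s') + s) :
    2 * (#(A \ prefixFamily (K + t + l) (K + t) (t + s + s') s) : ℝ) *
        #(prefixFamily (K + t + l) (K + t) (t + s + s') s') ≤
      #(prefixFamily (K + t + l) (K + t) (t + s + s') s) *
        #(prefixFamily (K + t + l) (K + t) (t + s + s') s' \ B) := by
  have hlk : 14 * (K + t) ≤ l := (Nat.mul_le_mul ht le_rfl).trans hl
  set A₀ := prefixFamily (K + t + l) (K + t) (t + s + s') s with hA₀
  have hmem : ∀ F ∈ A \ A₀, F ∈ A ∧ prefixCard F (t + s + s') + s < t + s + s' := by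
    intro F hF
    rw [mem_sdiff, hA₀, prefixFamily, mem_filter] at hF
    refine ⟨hF.1, ?_⟩
    by_contra! h
    exact hF.2 ⟨hA hF.1, h⟩
  rcases (A \ A₀).eq_empty_or_nonempty with he | hne
  · rw [he]; simp; positivity
  have hu' : IsUniformFamily (K + t + l) (K + t) (A \ A₀) := sdiff_subset.trans hA
  obtain ⟨lam, hlam, hall, F, hF, hFr⟩ := exists_level hu' hne (w₀ := u + 1) fun F hF =>
    (hAr F (hmem F hF).1).resolve_right (by have := (hmem F hF).2; omega)
  obtain ⟨r, rfl⟩ := Nat.exists_eq_add_of_le hlam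
  have hrk : u + 1 + r ≤ K + t := by
    have := (hall F hF).le_card
    rwa [(mem_powersetCard.1 (hu' hF)).2] at this
  have hgain : (#(A \ A₀) : ℝ) * (t : ℝ) ^ r ≤ ((K + t + l).choose (l + (u + 1)) : ℝ) := by
    have h1 := card_le_of_forall_reaches (l := l) rfl (by omega) hu' hall
    have h2 := choose_add_mul_pow_le (show 0 < K + t by omega) hl rfl (u + 1) r
    exact_mod_cast (Nat.mul_le_mul_right _ h1).trans h2
  have hloss := choose_mul_le_card_sdiff (l := l) (t := t) (T := t + s + s') (s := s) (s' := s')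
    (u := u) (r := r) rfl hA hAs hAB rfl (by omega) (by omega) (by omega) (by omega)
    (hmem F hF).1 (hmem F hF).2 (by rwa [show u + r + 2 = u + 1 + r + 1 by omega])
  rw [show K + t + l - (t + s + s') = K + l - (s + s') by omega] at hloss
  have h1 := choose_le_mul_choose ht hl hs hs' hu hs'K
  have h2 := card_prefixFamily_le ht hl hs hs' (by omega)
  have h3 := choose_sub_choose_ge (r := r) ht hl hsK hs' (by omega)
  have h4 := choose_mul_choose_le_card_prefixFamily (n := K + t + l) (k := K + t) (l := l)
    (T := t + s + s') (s := s) rfl (by omega) (by omega) (by omega)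
  rw [show K + t + l - (t + s + s') = K + l - (s + s') by omega, ← hA₀] at h4
  have h4' : ((t + s + s').choose s : ℝ) * ((K + l - (s + s')).choose (l - s) : ℝ) ≤ (#A₀ : ℝ) := by
    exact_mod_cast h4
  have hloss' := (Nat.cast_le (α := ℝ)).2 hloss
  rw [Nat.cast_mul] at hloss'
  set L : ℝ := (((K + l - (s + s') - (r + 3)).choose (l - s' - (r + 3)) -
        (K + l - (s + s') - (r + 3)).choose (l - s' - (r + 3) + 2) : ℕ) : ℝ)
  set cv : ℝ := ((K + l - (s + s')).choose (l - s') : ℝ)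
  set b₀ : ℝ := (#(prefixFamily (K + t + l) (K + t) (t + s + s') s') : ℝ)
  set Z : ℝ := (t.choose s' : ℝ)
  have hZ : 0 ≤ Z := Nat.cast_nonneg _
  have hcv : 0 ≤ cv := Nat.cast_nonneg _
  have ht0 : (0 : ℝ) < (t : ℝ) ^ r := by positivity
  refine le_of_mul_le_mul_right ?_ ht0
  calc 2 * (#(A \ A₀) : ℝ) * b₀ * (t : ℝ) ^ r = 2 * (#(A \ A₀) * (t : ℝ) ^ r) * b₀ := by ring
    _ ≤ 2 * (0.21 * #A₀) * (7 / 6 * (Z * cv)) := by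
      refine mul_le_mul ?_ h2 (Nat.cast_nonneg _) (by positivity)
      linarith
    _ ≤ #A₀ * (Z * (0.77 * cv)) := by
      have : 0 ≤ (#A₀ : ℝ) * (Z * cv) := by positivity
      nlinarith
    _ ≤ #A₀ * (Z * ((t : ℝ) ^ r * L)) := by gcongr
    _ = #A₀ * (Z * L) * (t : ℝ) ^ r := by ring
    _ ≤ _ := by gcongr

end Units

/-! ### Products of the extremal families -/

lemma card_prefixFamily_one_mul {t K l : ℕ} (ht : 14 ≤ t) (hl : t * (K + t) ≤ l) (hK : 1 ≤ K) :
    (#(prefixFamily (K + t + l) (K + t) (t + 1) 1) : ℝ) *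
        #(prefixFamily (K + t + l) (K + t) (t + 1) 0) ≤
      (1 - 1 / (2 * t)) * ((K + l).choose l : ℝ) ^ 2 := by
  have hl0 : 0 < l := lt_of_lt_of_le (by positivity) hl
  have ht' : (14 : ℝ) ≤ t := by exact_mod_cast ht
  have htK : (t : ℝ) * K ≤ l := by
    have : t * K ≤ l := (Nat.mul_le_mul le_rfl (by omega)).trans hl
    exact_mod_cast this
  rw [card_prefixFamily_one (l := l) rfl (by omega) (by omega) hl0,
    card_prefixFamily_zero (l := l) rfl (by omega)]
  obtain ⟨a, rfl⟩ := Nat.exists_eq_add_of_le' hK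
  obtain ⟨b, rfl⟩ := Nat.exists_eq_add_of_le' hl0
  rw [show a + 1 + t + (b + 1) - (t + 1) = a + b + 1 by omega, Nat.add_sub_cancel,
    show a + 1 + (b + 1) = a + b + 1 + 1 by omega]
  have h1 := Nat.add_one_mul_choose_eq (a + b + 1) b
  have h2 := Nat.choose_mul_succ_eq (a + b + 1) (b + 1)
  rw [show a + b + 1 + 1 - (b + 1) = a + 1 by omega] at h2
  have e1 : ((a : ℝ) + b + 1 + 1) * ((a + b + 1).choose b : ℝ) =
    ((a + b + 1 + 1).choose (b + 1) : ℝ) * (b + 1) := by exact_mod_cast h1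
  have e2 : ((a + b + 1).choose (b + 1) : ℝ) * (a + b + 1 + 1) =
    ((a + b + 1 + 1).choose (b + 1) : ℝ) * (a + 1) := by exact_mod_cast h2
  push_cast at htK ⊢
  set c : ℝ := ((a + b + 1).choose b : ℝ)
  set c' : ℝ := ((a + b + 1).choose (b + 1) : ℝ)
  set C : ℝ := ((a + b + 1 + 1).choose (b + 1) : ℝ)
  have ha : (0 : ℝ) ≤ a := Nat.cast_nonneg a
  have hb : (0 : ℝ) ≤ b := Nat.cast_nonneg b
  have hM : (0 : ℝ) < (a + b + 1 + 1) ^ 2 := by positivity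
  refine le_of_mul_le_mul_right ?_ hM
  have key : ((t + 1) * (b + 1) + (a + 1 : ℝ)) * (a + 1) ≤
      (1 - 1 / (2 * t)) * (a + b + 1 + 1) ^ 2 := by
    have h3 : (1 : ℝ) / (2 * t) * (a + b + 1 + 1) ^ 2 ≤ (b + 1) * (b + 1 - (t - 1) * (a + 1)) := by
      rw [div_mul_eq_mul_div, one_mul, div_le_iff₀ (by positivity)]
      have h4 : (a : ℝ) + b + 1 + 1 ≤ 15 / 14 * (b + 1) := by nlinarith
      have h5 : ((a : ℝ) + b + 1 + 1) ^ 2 ≤ (15 / 14 * (b + 1)) ^ 2 := by gcongr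
      have h6 : (b + 1 : ℝ) ≤ t * (b + 1 - (t - 1) * (a + 1)) := by nlinarith
      nlinarith
    nlinarith
  calc ((t + 1) * c + c') * c' * (a + b + 1 + 1) ^ 2
      = ((t + 1) * ((a + b + 1 + 1) * c) + c' * (a + b + 1 + 1)) * (c' * (a + b + 1 + 1)) := by ring
    _ = C ^ 2 * (((t + 1) * (b + 1) + (a + 1 : ℝ)) * (a + 1)) := by rw [e1, e2]; ring
    _ ≤ C ^ 2 * ((1 - 1 / (2 * t)) * (a + b + 1 + 1) ^ 2) := by gcongr
    _ = _ := by ring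

/-- The one estimate that needs the gap `δ`: at `n = (t + 1) * k` the family of all sets with at
least `t + 1` elements in `[t + 2]` has about the size of that of all sets containing `[t]`. -/
lemma card_prefixFamily_one_le {t K l : ℕ} {δ : ℝ} (ht : 14 ≤ t) (hδ : 0 < δ)
    (hl : (t + δ) * (K + t) ≤ l) (hK : 1 ≤ K) :
    (#(prefixFamily (K + t + l) (K + t) (t + 2) 1) : ℝ) ≤
      (1 - δ / (2 * (t + δ))) * ((K + l).choose l : ℝ) := by
  have ht' : (14 : ℝ) ≤ t := by exact_mod_cast ht
  have hl0 : 0 < l := by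
    have : (0 : ℝ) < l := lt_of_lt_of_le (by positivity) hl
    exact_mod_cast this
  have htK : (t : ℝ) * K ≤ l := le_trans (by nlinarith [(Nat.cast_nonneg K : (0 : ℝ) ≤ K)]) hl
  rw [card_prefixFamily_one (l := l) rfl (by omega) (by omega) hl0]
  obtain ⟨a, rfl⟩ := Nat.exists_eq_add_of_le' hK
  obtain ⟨b, rfl⟩ := Nat.exists_eq_add_of_le' hl0
  rw [show a + 1 + t + (b + 1) - (t + 2) = a + b by omega, Nat.add_sub_cancel,
    show a + 1 + (b + 1) = a + b + 1 + 1 by omega]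
  have h1 := Nat.add_one_mul_choose_eq (a + b) b
  have h2 := Nat.choose_mul_succ_eq (a + b + 1) (b + 1)
  have h3 := Nat.choose_mul_succ_eq (a + b) (b + 1)
  rw [show a + b + 1 + 1 - (b + 1) = a + 1 by omega] at h2
  rw [show a + b + 1 - (b + 1) = a by omega] at h3
  have e1 : ((a : ℝ) + b + 1) * ((a + b).choose b : ℝ) =
    ((a + b + 1).choose (b + 1) : ℝ) * (b + 1) := by exact_mod_cast h1
  have e2 : ((a + b + 1).choose (b + 1) : ℝ) * (a + b + 1 + 1) =
    ((a + b + 1 + 1).choose (b + 1) : ℝ) * (a + 1) := by exact_mod_cast h2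
  have e3 : ((a + b).choose (b + 1) : ℝ) * (a + b + 1) =
    ((a + b + 1).choose (b + 1) : ℝ) * a := by exact_mod_cast h3
  push_cast at htK hl ⊢
  set c : ℝ := ((a + b).choose b : ℝ)
  set c' : ℝ := ((a + b).choose (b + 1) : ℝ)
  set D : ℝ := ((a + b + 1).choose (b + 1) : ℝ)
  set C : ℝ := ((a + b + 1 + 1).choose (b + 1) : ℝ)
  have hC : 0 ≤ C := Nat.cast_nonneg _
  have ha : (0 : ℝ) ≤ a := Nat.cast_nonneg a
  have hb : (0 : ℝ) ≤ b := Nat.cast_nonneg b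
  have hM : (0 : ℝ) < (a + b + 1) * (a + b + 1 + 1) := by positivity
  refine le_of_mul_le_mul_right ?_ hM
  have key : ((t + 2) * (b + 1) + (a : ℝ)) * (a + 1) ≤
      (1 - δ / (2 * (t + δ))) * ((a + b + 1) * (a + b + 1 + 1)) := by
    have h4 : δ / (2 * (t + δ)) * ((a + b + 1) * (a + b + 1 + 1)) ≤
        (b + 1) * (b - t * (a + 1)) := by
      rw [div_mul_eq_mul_div, div_le_iff₀ (by positivity)]
      have h5 : (a : ℝ) + b + 1 + 1 ≤ 15 / 14 * (b + 1) := by nlinarith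
      have h6 : ((a : ℝ) + b + 1) * (a + b + 1 + 1) ≤ 2 * (b + 1) ^ 2 := by nlinarith
      have h7 : δ * (b + 1) ≤ (t + δ) * (b - t * (a + 1)) := by
        have h8 : 0 ≤ (t + δ) * ((t : ℝ) ^ 2 - 1) := mul_nonneg (by linarith) (by nlinarith)
        nlinarith [mul_le_mul_of_nonneg_left hl (show (0 : ℝ) ≤ t by linarith)]
      calc δ * ((a + b + 1) * (a + b + 1 + 1)) ≤ δ * (2 * (b + 1) ^ 2) := by gcongr
        _ = 2 * (b + 1) * (δ * (b + 1)) := by ring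
        _ ≤ 2 * (b + 1) * ((t + δ) * (b - t * (a + 1))) := by gcongr
        _ = _ := by ring
    linarith
  calc ((t + 2) * c + c') * ((a + b + 1) * (a + b + 1 + 1))
      = ((t + 2) * ((a + b + 1) * c) + c' * (a + b + 1)) * (a + b + 1 + 1) := by ring
    _ = ((t + 2) * (b + 1) + (a : ℝ)) * (D * (a + b + 1 + 1)) := by rw [e1, e3]; ring
    _ = C * (((t + 2) * (b + 1) + (a : ℝ)) * (a + 1)) := by rw [e2]; ring
    _ ≤ C * ((1 - δ / (2 * (t + δ))) * ((a + b + 1) * (a + b + 1 + 1))) := by gcongr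
    _ = _ := by ring

/-! ### Stability -/

lemma mul_le_mul_of_gain_le_loss {a₀ b₀ x y g h : ℝ} (ha : 0 < a₀) (hb : 0 < b₀) (hx : x ≤ a₀)
    (hy : y ≤ b₀) (hg : 2 * g * b₀ ≤ a₀ * y) (hh : 2 * h * a₀ ≤ b₀ * x)
    (hB : 0 ≤ b₀ - y + h) :
    (a₀ - x + g) * (b₀ - y + h) ≤ a₀ * b₀ * (1 - (x / a₀ + y / b₀) / 4) ^ 2 := by
  have h1 : g ≤ a₀ * (y / b₀ / 2) := by
    rw [div_div, mul_div_assoc', le_div_iff₀ (by positivity)]; linarith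
  have h2 : h ≤ b₀ * (x / a₀ / 2) := by
    rw [div_div, mul_div_assoc', le_div_iff₀ (by positivity)]; linarith
  have hX : x = a₀ * (x / a₀) := by field_simp
  have hY : y = b₀ * (y / b₀) := by field_simp
  have hX1 : x / a₀ ≤ 1 := (div_le_one ha).2 hx
  have hY1 : y / b₀ ≤ 1 := (div_le_one hb).2 hy
  set X := x / a₀
  set Y := y / b₀
  have hA' : a₀ - x + g ≤ a₀ * (1 - X + Y / 2) := by linarith
  have hB' : b₀ - y + h ≤ b₀ * (1 - Y + X / 2) := by linarith
  have hYX : 0 ≤ 1 - Y + X / 2 := by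
    by_contra! hc
    have := mul_neg_of_pos_of_neg hb hc
    linarith
  by_cases hXY : 0 ≤ 1 - X + Y / 2
  · calc (a₀ - x + g) * (b₀ - y + h)
        ≤ (a₀ * (1 - X + Y / 2)) * (b₀ * (1 - Y + X / 2)) := by
          refine mul_le_mul hA' hB' hB (by positivity)
      _ = a₀ * b₀ * ((1 - X + Y / 2) * (1 - Y + X / 2)) := by ring
      _ ≤ _ := by gcongr; nlinarith [sq_nonneg (X - Y)]
  · push Not at hXY
    have h3 : a₀ - x + g ≤ 0 := hA'.trans (mul_nonpos_of_nonneg_of_nonpos ha.le hXY.le)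
    exact (mul_nonpos_of_nonpos_of_nonneg h3 hB).trans (by positivity)

lemma crossIntersecting_comm {t : ℕ} {A B : Finset (Finset ℕ)} (h : CrossIntersecting t A B) :
    CrossIntersecting t B A := fun G hG F hF => by rw [inter_comm]; exact h F hF G hG

lemma cast_card_eq_sub_add (A A₀ : Finset (Finset ℕ)) :
    (#A : ℝ) = #A₀ - #(A₀ \ A) + #(A \ A₀) := by
  have h1 := card_sdiff_add_card_inter A A₀
  have h2 := card_sdiff_add_card_inter A₀ A
  rw [inter_comm] at h2
  have h1' : (#(A \ A₀) : ℝ) + #(A ∩ A₀) = #A := by exact_mod_cast h1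
  have h2' : (#(A₀ \ A) : ℝ) + #(A ∩ A₀) = #A₀ := by exact_mod_cast h2
  linarith

lemma card_symmDiff_eq (A A₀ : Finset (Finset ℕ)) :
    (#(symmDiff A A₀) : ℝ) = #(A \ A₀) + #(A₀ \ A) := by
  have h : #(symmDiff A A₀) = #(A \ A₀) + #(A₀ \ A) :=
    card_union_of_disjoint disjoint_sdiff_sdiff
  exact_mod_cast h

/-- Balanced gains and losses never raise the product above that of the extremal families. -/
lemma card_mul_card_le_of_gain_le_loss {A B A₀ B₀ : Finset (Finset ℕ)} (hA : 0 < #A₀)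
    (hB : 0 < #B₀) (h1 : 2 * (#(A \ A₀) : ℝ) * #B₀ ≤ #A₀ * #(B₀ \ B))
    (h2 : 2 * (#(B \ B₀) : ℝ) * #A₀ ≤ #B₀ * #(A₀ \ A)) :
    (#A : ℝ) * #B ≤ #A₀ * #B₀ * (1 - (#(A₀ \ A) / #A₀ + #(B₀ \ B) / #B₀ : ℝ) / 4) ^ 2 := by
  have eB := cast_card_eq_sub_add B B₀
  rw [cast_card_eq_sub_add A A₀, eB]
  refine mul_le_mul_of_gain_le_loss (by exact_mod_cast hA) (by exact_mod_cast hB)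
    (by exact_mod_cast card_le_card sdiff_subset) (by exact_mod_cast card_le_card sdiff_subset)
    h1 h2 ?_
  rw [← eB]
  positivity

lemma card_mul_card_le_mul {A B A₀ B₀ : Finset (Finset ℕ)} (hA : 0 < #A₀)
    (hB : 0 < #B₀) (h1 : 2 * (#(A \ A₀) : ℝ) * #B₀ ≤ #A₀ * #(B₀ \ B))
    (h2 : 2 * (#(B \ B₀) : ℝ) * #A₀ ≤ #B₀ * #(A₀ \ A)) :
    (#A : ℝ) * #B ≤ #A₀ * #B₀ := by
  refine (card_mul_card_le_of_gain_le_loss hA hB h1 h2).trans ?_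
  have hA' : (0 : ℝ) < #A₀ := by exact_mod_cast hA
  have hB' : (0 : ℝ) < #B₀ := by exact_mod_cast hB
  have hX : (#(A₀ \ A) / #A₀ : ℝ) ≤ 1 :=
    (div_le_one hA').2 (by exact_mod_cast card_le_card sdiff_subset)
  have hY : (#(B₀ \ B) / #B₀ : ℝ) ≤ 1 :=
    (div_le_one hB').2 (by exact_mod_cast card_le_card sdiff_subset)
  have hX0 : (0 : ℝ) ≤ #(A₀ \ A) / #A₀ := by positivity
  have hY0 : (0 : ℝ) ≤ #(B₀ \ B) / #B₀ := by positivity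
  refine mul_le_of_le_one_right (by positivity) ?_
  nlinarith

/-- The product is bounded away from the maximum unless both families are close to the family of
all sets containing `[t]`, with gains dominated by losses. -/
lemma product_dichotomy {t K l : ℕ} {δ : ℝ} (ht : 14 ≤ t) (hδ : 0 < δ)
    (hl : (t + δ) * (K + t) ≤ l) {A B : Finset (Finset ℕ)}
    (hA : IsUniformFamily (K + t + l) (K + t) A) (hB : IsUniformFamily (K + t + l) (K + t) B)
    (hAs : IsShifted (K + t + l) A) (hBs : IsShifted (K + t + l) B)
    (hAB : CrossIntersecting t A B) (hAne : A.Nonempty) (hBne : B.Nonempty) :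
    (#A : ℝ) * #B ≤ (1 - min (1 / 80 : ℝ) (min (1 / (2 * (t : ℝ))) (δ / (2 * (t + δ))))) *
        ((K + l).choose l : ℝ) ^ 2 ∨
      2 * (#(A \ prefixFamily (K + t + l) (K + t) t 0) : ℝ) *
          #(prefixFamily (K + t + l) (K + t) t 0) ≤
        #(prefixFamily (K + t + l) (K + t) t 0) *
          #(prefixFamily (K + t + l) (K + t) t 0 \ B) ∧
      2 * (#(B \ prefixFamily (K + t + l) (K + t) t 0) : ℝ) *
          #(prefixFamily (K + t + l) (K + t) t 0) ≤
        #(prefixFamily (K + t + l) (K + t) t 0) *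
          #(prefixFamily (K + t + l) (K + t) t 0 \ A) := by
  have ht' : (14 : ℝ) ≤ t := by exact_mod_cast ht
  have hlN : t * (K + t) ≤ l := by
    have : (t : ℝ) * (K + t) ≤ l := le_trans (by gcongr; linarith) hl
    exact_mod_cast this
  have hlk : 14 * (K + t) ≤ l := (Nat.mul_le_mul ht le_rfl).trans hlN
  have hgE := choose_add_le_mul (show 0 < t by omega) hlN
  set m : ℝ := min (1 / 80) (min (1 / (2 * t)) (δ / (2 * (t + δ)))) with hm
  have hm1 : m ≤ 1 / 80 := min_le_left _ _
  have hm2 : m ≤ 1 / (2 * t) := (min_le_right _ _).trans (min_le_left _ _)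
  have hm3 : m ≤ δ / (2 * (t + δ)) := (min_le_right _ _).trans (min_le_right _ _)
  have hm0 : 0 < m := by
    simp only [hm, lt_min_iff]
    exact ⟨by norm_num, by positivity, by positivity⟩
  have hC2 : 0 ≤ ((K + l).choose l : ℝ) ^ 2 := by positivity
  have hgsq : ((K + t + l).choose (l + t) : ℝ) ^ 2 ≤ 2.719 ^ 2 * ((K + l).choose l : ℝ) ^ 2 := by
    rw [← mul_pow]
    gcongr
  -- Outside the case `s, s' ≤ 1` the product is at most `0.986` times the square of the binomial.
  have hfin : ∀ x : ℝ, x ≤ 0.986 * ((K + l).choose l : ℝ) ^ 2 →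
      x ≤ (1 - m) * ((K + l).choose l : ℝ) ^ 2 := fun x hx => hx.trans (by gcongr; linarith)
  obtain ⟨u, v, hAu, hBv, hI | ⟨huv, hII | hII | ⟨T, s, s', hT, hTu, hTv, hTn, hTs, hTs', hu1, hv1,
    hAT, hBT⟩⟩⟩ := level_trichotomy (l := l) rfl (by omega) (by omega) (by omega) hA hB hAs hAB
      hAne hBne
  · refine Or.inl (hfin _ ?_)
    have h1 := choose_mul_choose_mul_le (show 0 < t by omega) (show 0 < K + t by omega) hlN rfl hI
    have h2 : (#A : ℝ) * #B * t ≤ ((K + t + l).choose (l + t) : ℝ) ^ 2 := by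
      exact_mod_cast (Nat.mul_le_mul_right t (Nat.mul_le_mul hAu hBv)).trans h1
    have : (0 : ℝ) ≤ (#A : ℝ) * #B := by positivity
    nlinarith
  · refine Or.inl (hfin _ ?_)
    have h1 := choose_pred_mul_le (show 0 < K + t by omega) hlN rfl u
    have h2 : #A * #B * (t + 1) ≤ 2 * (K + t + l).choose (l + t) ^ 2 := by
      calc #A * #B * (t + 1)
          ≤ (2 * (K + t + l - 1).choose (l + u)) * (K + t + l).choose (l + v) * (t + 1) :=
            Nat.mul_le_mul_right _ (Nat.mul_le_mul hII hBv)
        _ = 2 * (((K + t + l - 1).choose (l + u) * (t + 1)) * (K + t + l).choose (l + v)) := by ring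
        _ ≤ 2 * ((K + t + l).choose (l + u) * (K + t + l).choose (l + v)) := by gcongr
        _ ≤ _ := Nat.mul_le_mul_left _ (choose_mul_choose_le_sq huv)
    have h3 : (#A : ℝ) * #B * (t + 1) ≤ 2 * ((K + t + l).choose (l + t) : ℝ) ^ 2 := by
      exact_mod_cast h2
    have : (0 : ℝ) ≤ (#A : ℝ) * #B := by positivity
    nlinarith
  · refine Or.inl (hfin _ ?_)
    have h1 := choose_pred_mul_le (show 0 < K + t by omega) hlN rfl v
    have h2 : #A * #B * (t + 1) ≤ 2 * (K + t + l).choose (l + t) ^ 2 := by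
      calc #A * #B * (t + 1)
          ≤ (K + t + l).choose (l + u) * (2 * (K + t + l - 1).choose (l + v)) * (t + 1) :=
            Nat.mul_le_mul_right _ (Nat.mul_le_mul hAu hII)
        _ = 2 * ((K + t + l).choose (l + u) * ((K + t + l - 1).choose (l + v) * (t + 1))) := by ring
        _ ≤ 2 * ((K + t + l).choose (l + u) * (K + t + l).choose (l + v)) := by gcongr
        _ ≤ _ := Nat.mul_le_mul_left _ (choose_mul_choose_le_sq huv)
    have h3 : (#A : ℝ) * #B * (t + 1) ≤ 2 * ((K + t + l).choose (l + t) : ℝ) ^ 2 := by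
      exact_mod_cast h2
    have : (0 : ℝ) ≤ (#A : ℝ) * #B := by positivity
    nlinarith
  subst hT
  by_cases hss : s ≤ 1 ∧ s' ≤ 1
  · obtain ⟨hs, hs'⟩ := hss
    have g1 := two_mul_gain_le_loss ht hlN hs hs' (show u + s = t + s' by omega) (by omega)
      (by omega) hA hAs hAB hAT
    have g2 := two_mul_gain_le_loss ht hlN hs' hs (show v + s' = t + s by omega) (by omega)
      (by omega) hB hBs (crossIntersecting_comm hAB) (by
        rw [show t + s' + s = t + s + s' by omega]; exact hBT)
    rw [show t + s' + s = t + s + s' by omega] at g2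
    have hpos : ∀ r ≤ 1, 0 < #(prefixFamily (K + t + l) (K + t) (t + s + s') r) ∨
        K + r < s + s' := by
      intro r hr
      by_cases hrK : K + r < s + s'
      · exact Or.inr hrK
      · refine Or.inl (lt_of_lt_of_le ?_ (choose_mul_choose_le_card_prefixFamily (l := l)
          (T := t + s + s') (s := r) rfl (by omega) (by omega) (by omega)))
        exact Nat.mul_pos (Nat.choose_pos (by omega)) (Nat.choose_pos (by omega))
    have p1 := (hpos s hs).resolve_right (by omega)
    have p2 := (hpos s' hs').resolve_right (by omega)
    by_cases h00 : s = 0 ∧ s' = 0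
    · obtain ⟨rfl, rfl⟩ := h00
      exact Or.inr ⟨g1, g2⟩
    left
    refine (card_mul_card_le_mul p1 p2 g1 g2).trans ?_
    have hs01 : s = 0 ∧ s' = 1 ∨ s = 1 ∧ s' = 0 ∨ s = 1 ∧ s' = 1 := by omega
    rcases hs01 with ⟨rfl, rfl⟩ | ⟨rfl, rfl⟩ | ⟨rfl, rfl⟩
    · rw [mul_comm]
      refine (card_prefixFamily_one_mul ht hlN (by omega)).trans ?_
      gcongr
    · refine (card_prefixFamily_one_mul ht hlN (by omega)).trans ?_
      gcongr
    · have h1 := card_prefixFamily_one_le ht hδ hl (show 1 ≤ K by omega)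
      have h2 : (#(prefixFamily (K + t + l) (K + t) (t + 1 + 1) 1) : ℝ) ≤
          (1 - m) * ((K + l).choose l : ℝ) := h1.trans (by gcongr)
      calc _ ≤ ((1 - m) * ((K + l).choose l : ℝ)) * ((1 - m) * ((K + l).choose l : ℝ)) := by
            exact mul_le_mul h2 h2 (Nat.cast_nonneg _) (mul_nonneg (by linarith) (by positivity))
        _ = (1 - m) * ((1 - m) * ((K + l).choose l : ℝ) ^ 2) := by ring
        _ ≤ _ := mul_le_of_le_one_left (mul_nonneg (by linarith) hC2) (by linarith)
  · refine Or.inl (hfin _ ?_)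
    have hA' := card_le_of_forall_reaches_or (l := l) rfl (by omega) hA hTn hTu (by omega) hAT
    have hB' := card_le_of_forall_reaches_or (l := l) rfl (by omega) hB hTn hTv (by omega) hBT
    rw [show K + t + l - (t + s + s') = K + l - (s + s') by omega] at hA' hB'
    have hA'' := (Nat.cast_le (α := ℝ)).2 hA'
    have hB'' := (Nat.cast_le (α := ℝ)).2 hB'
    push_cast at hA'' hB''
    rcases le_total s' s with h | h
    · refine (card_mul_card_le_of_two_le ht hlN (by omega) h (by omega) (by omega) hu1 (by omega)
        (by omega) (Nat.cast_nonneg _) hA'' hB'').trans ?_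
      gcongr
      norm_num
    · rw [mul_comm]
      rw [show t + s + s' = t + s' + s by omega, show s + s' = s' + s by omega] at hA'' hB''
      refine (card_mul_card_le_of_two_le ht hlN (by omega) h (by omega) (by omega) hv1 (by omega)
        (by omega) (Nat.cast_nonneg _) hB'' hA'').trans ?_
      gcongr
      norm_num

end ShiftedFamilies

theorem theorem2 (t : ℕ) (ht : 14 ≤ t) (δ : ℝ) (hδ : 0 < δ) :
    ∃ γ : ℝ, 0 < γ ∧ γ ≤ 1 ∧
      ∀ (k n : ℕ), t ≤ k → ((t : ℝ) + 1 + δ) * (k : ℝ) ≤ (n : ℝ) →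
      ∀ η : ℝ, 0 < η → η ≤ 1 →
      ∀ A B : Finset (Finset ℕ), IsUniformFamily n k A → IsUniformFamily n k B →
        IsShifted n A → IsShifted n B → CrossIntersecting t A B →
        Real.sqrt ((A.card : ℝ) * (B.card : ℝ)) < (1 - γ * η) * ((n - t).choose (k - t) : ℝ) ∨
        ((symmDiff A (franklFamily 0 t n k)).card : ℝ)
            + ((symmDiff B (franklFamily 0 t n k)).card : ℝ)
          < η * ((n - t).choose (k - t) : ℝ) := by
  have ht' : (14 : ℝ) ≤ t := by exact_mod_cast ht
  set m : ℝ := min (1 / 80) (min (1 / (2 * t)) (δ / (2 * (t + δ)))) with hm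
  have hm1 : m ≤ 1 / 80 := min_le_left _ _
  have hm0 : 0 < m := by
    simp only [hm, lt_min_iff]
    exact ⟨by norm_num, by positivity, by positivity⟩
  refine ⟨m / 4, by linarith, by linarith, ?_⟩
  intro k n hk hn η hη hη1 A B hA hB hAs hBs hAB
  obtain ⟨K, rfl⟩ := Nat.exists_eq_add_of_le' hk
  have hkn : K + t ≤ n := by
    have : ((K + t : ℕ) : ℝ) ≤ n := le_trans (by
      have : (0 : ℝ) ≤ ((K + t : ℕ) : ℝ) := Nat.cast_nonneg _
      nlinarith) hn
    exact_mod_cast this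
  obtain ⟨l, rfl⟩ := Nat.exists_eq_add_of_le hkn
  have hl : (t + δ) * (K + t) ≤ (l : ℝ) := by push_cast at hn; linarith
  have hchoose : (K + t + l - t).choose (K + t - t) = (K + l).choose l := by
    rw [show K + t + l - t = K + l by omega, Nat.add_sub_cancel]
    exact Nat.choose_symm_add
  rw [hchoose, ShiftedFamilies.franklFamily_zero]
  have hC : (0 : ℝ) < ((K + l).choose l : ℝ) := by
    exact_mod_cast Nat.choose_pos (by omega)
  have hF₀ := ShiftedFamilies.card_prefixFamily_zero (k := K + t) (l := l) (T := t) rfl (by omega)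
  rw [show K + t + l - t = K + l by omega] at hF₀
  have hγη : m / 4 * η ≤ m / 4 := mul_le_of_le_one_right (by linarith) hη1
  have hγη0 : 0 < m / 4 * η := by positivity
  have hpos : 0 < (1 - m / 4 * η) * ((K + l).choose l : ℝ) := mul_pos (by linarith) hC
  rcases A.eq_empty_or_nonempty with rfl | hAne
  · left; simpa using hpos
  rcases B.eq_empty_or_nonempty with rfl | hBne
  · left; simpa using hpos
  rcases ShiftedFamilies.product_dichotomy ht hδ hl hA hB hAs hBs hAB hAne hBne with h | ⟨h1, h2⟩
  · left
    rw [Real.sqrt_lt' hpos]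
    refine h.trans_lt ?_
    rw [mul_pow]
    refine mul_lt_mul_of_pos_right ?_ (by positivity)
    rw [← hm]
    nlinarith [sq_nonneg (m / 4 * η)]
  · by_contra! hcon
    obtain ⟨hi, hii⟩ := hcon
    have hF₀pos : 0 < (ShiftedFamilies.prefixFamily (K + t + l) (K + t) t 0).card := by
      rw [hF₀]; exact Nat.choose_pos (by omega)
    have hle := ShiftedFamilies.card_mul_card_le_of_gain_le_loss hF₀pos hF₀pos h1 h2
    rw [ShiftedFamilies.card_symmDiff_eq, ShiftedFamilies.card_symmDiff_eq] at hii
    have hx1 : ((ShiftedFamilies.prefixFamily (K + t + l) (K + t) t 0 \ A).card : ℝ) ≤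
        (ShiftedFamilies.prefixFamily (K + t + l) (K + t) t 0).card := by
      exact_mod_cast Finset.card_le_card Finset.sdiff_subset
    have hy1 : ((ShiftedFamilies.prefixFamily (K + t + l) (K + t) t 0 \ B).card : ℝ) ≤
        (ShiftedFamilies.prefixFamily (K + t + l) (K + t) t 0).card := by
      exact_mod_cast Finset.card_le_card Finset.sdiff_subset
    rw [hF₀] at h1 h2 hle hx1 hy1
    set C : ℝ := ((K + l).choose l : ℝ)
    set x : ℝ := ((ShiftedFamilies.prefixFamily (K + t + l) (K + t) t 0 \ A).card : ℝ)
    set y : ℝ := ((ShiftedFamilies.prefixFamily (K + t + l) (K + t) t 0 \ B).card : ℝ)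
    set g : ℝ := ((A \ ShiftedFamilies.prefixFamily (K + t + l) (K + t) t 0).card : ℝ)
    set g' : ℝ := ((B \ ShiftedFamilies.prefixFamily (K + t + l) (K + t) t 0).card : ℝ)
    have hg : 2 * g ≤ y := le_of_mul_le_mul_right (by linarith) hC
    have hg' : 2 * g' ≤ x := le_of_mul_le_mul_right (by linarith) hC
    -- The losses make up at least two thirds of the symmetric differences.
    have hxy : 2 / 3 * η ≤ x / C + y / C := by
      rw [← add_div, le_div_iff₀ hC]
      linarith
    have hxC : x / C ≤ 1 := (div_le_one hC).2 hx1
    have hyC : y / C ≤ 1 := (div_le_one hC).2 hy1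
    have hlt : (A.card : ℝ) * B.card < ((1 - m / 4 * η) * C) ^ 2 := by
      refine hle.trans_lt ?_
      rw [mul_pow, mul_comm, ← sq]
      refine mul_lt_mul_of_pos_right ?_ (by positivity)
      refine pow_lt_pow_left₀ ?_ (by linarith) two_ne_zero
      nlinarith
    exact hi.not_gt ((Real.sqrt_lt' hpos).2 hlt)
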